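/- Let $(M,g)$ be a smooth, Hausdorff, paracompact Riemannian or Lorentzian manifold. An open set $U\subset M$ is called normal convex if for every $q\in U$ there is a starshaped open neighbourhood $V$ of the origin of $T_qM$, contained in the domain of the exponential map $\exp_q$ of $g$, such that $\exp_q: V\to U$ is a diffeomorphism. Let $\mathcal{A}$ be a covering of $M$ made of open sets (possibly $\mathcal{A}=\{M\}$). Then there exists a covering $\mathcal{C}$ of $M$ such that (a) $\mathcal{C}$ is a refinement of $\mathcal{A}$ made of normal convex open sets: every $C\in\mathcal{C}$ is a normal convex open set and $C\subset A$ for some $A\in\mathcal{A}$; (b) if $C,C'\in\mathcal{C}$ and $C\cap C'\neq\emptyset$, then $C\cap C'$ is a normal convex open set. In other words, $\mathcal{C}$ is a strongly convex covering of $M$ that refines $\mathcal{A}$. -/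

import Mathlib

open Set Manifold
open scoped ContDiff Bundle

noncomputable section

namespace SemiRiemannian

/-- A smooth symmetric `(0,2)`-tensor field on the smooth `n`-dimensional manifold `M`: a symmetric
bilinear form `g p` on each tangent space `T_pM` that depends smoothly on `p` (as a section of the
bundle of bilinear forms). It is a Riemannian, or a Lorentzian, metric when it satisfies the
predicate `IsRiemannian`, or `IsLorentzian`, below. -/
structure SymmetricTensorField (n : ℕ) (M : Type*) [TopologicalSpace M]
    [ChartedSpace (EuclideanSpace ℝ (Fin n)) M] [IsManifold (𝓡 n) ∞ M] where
  /-- The bilinear form on each tangent space. -/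
  form (p : M) : TangentSpace (𝓡 n) p →L[ℝ] TangentSpace (𝓡 n) p →L[ℝ] ℝ
  symm (p : M) (v w : TangentSpace (𝓡 n) p) : form p v w = form p w v
  contMDiff : ContMDiff (𝓡 n)
    ((𝓡 n).prod 𝓘(ℝ, EuclideanSpace ℝ (Fin n) →L[ℝ] EuclideanSpace ℝ (Fin n) →L[ℝ] ℝ)) ∞
    (fun p : M ↦ Bundle.TotalSpace.mk'
      (EuclideanSpace ℝ (Fin n) →L[ℝ] EuclideanSpace ℝ (Fin n) →L[ℝ] ℝ)
      (E := fun p : M ↦ TangentSpace (𝓡 n) p →L[ℝ] TangentSpace (𝓡 n) p →L[ℝ] ℝ) p (form p))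

variable {n : ℕ} {M : Type*} [TopologicalSpace M]
  [ChartedSpace (EuclideanSpace ℝ (Fin n)) M] [IsManifold (𝓡 n) ∞ M]

namespace SymmetricTensorField

/-- `g` is a Riemannian metric: it is positive definite at every point. -/
def IsRiemannian (g : SymmetricTensorField n M) : Prop :=
  ∀ (p : M) (v : TangentSpace (𝓡 n) p), v ≠ 0 → 0 < g.form p v v

/-- `g` is a Lorentzian metric: it has signature `(-,+,…,+)` at every point, i.e. there is a vector
`v` with `g(v,v) < 0` such that `g` is positive definite on the `g`-orthogonal complement of `v`. -/
def IsLorentzian (g : SymmetricTensorField n M) : Prop :=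
  ∀ p : M, ∃ v : TangentSpace (𝓡 n) p, g.form p v v < 0 ∧
    ∀ w : TangentSpace (𝓡 n) p, g.form p v w = 0 → w ≠ 0 → 0 < g.form p w w

/-- The matrix `g_{ij}(y) = g(∂_i, ∂_j)` of `g` in the chart `φ`, as a function of the coordinate
point `y ∈ φ.target` (a junk value elsewhere); `∂_i = d(φ⁻¹)_y e_i` are the coordinate vectors. -/
def coordMatrix (g : SymmetricTensorField n M)
    (φ : OpenPartialHomeomorph M (EuclideanSpace ℝ (Fin n))) (y : EuclideanSpace ℝ (Fin n)) :
    Matrix (Fin n) (Fin n) ℝ :=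
  Matrix.of fun i j ↦ g.form (φ.symm y)
    (mfderiv (𝓡 n) (𝓡 n) φ.symm y (EuclideanSpace.single i (1 : ℝ)))
    (mfderiv (𝓡 n) (𝓡 n) φ.symm y (EuclideanSpace.single j (1 : ℝ)))

/-- The partial derivative `∂_i g_{jl}` at `y` in the chart `φ`. -/
def coordMatrixDeriv (g : SymmetricTensorField n M)
    (φ : OpenPartialHomeomorph M (EuclideanSpace ℝ (Fin n))) (y : EuclideanSpace ℝ (Fin n))
    (i j l : Fin n) : ℝ :=
  fderiv ℝ (fun z ↦ g.coordMatrix φ z j l) y (EuclideanSpace.single i (1 : ℝ))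

/-- The Christoffel symbol of the Levi-Civita connection of `g` in the chart `φ`,
`Γ^k_{ij} = ½ ∑_l g^{kl} (∂_i g_{jl} + ∂_j g_{il} - ∂_l g_{ij})`. -/
def christoffel (g : SymmetricTensorField n M)
    (φ : OpenPartialHomeomorph M (EuclideanSpace ℝ (Fin n))) (y : EuclideanSpace ℝ (Fin n))
    (k i j : Fin n) : ℝ :=
  (1 / 2 : ℝ) * ∑ l, (g.coordMatrix φ y)⁻¹ k l *
    (g.coordMatrixDeriv φ y i j l + g.coordMatrixDeriv φ y j i l - g.coordMatrixDeriv φ y l i j)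

/-- `γ` is a geodesic of `g` on the open set `J` of parameters: it is smooth there and satisfies
`ẍ^k + ∑_{i,j} Γ^k_{ij}(x) ẋ^i ẋ^j = 0` for its coordinates `x^k` in every chart of the (maximal)
smooth atlas. -/
def IsGeodesicOn (g : SymmetricTensorField n M) (γ : ℝ → M) (J : Set ℝ) : Prop :=
  ContMDiffOn 𝓘(ℝ, ℝ) (𝓡 n) ∞ γ J ∧
  ∀ t ∈ J, ∀ φ ∈ IsManifold.maximalAtlas (𝓡 n) ∞ M, γ t ∈ φ.source → ∀ k : Fin n,
    deriv (deriv fun s ↦ φ (γ s) k) t +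
      ∑ i, ∑ j, g.christoffel φ (φ (γ t)) k i j *
        deriv (fun s ↦ φ (γ s) i) t * deriv (fun s ↦ φ (γ s) j) t = 0

/-- `γ` is a geodesic with `γ(0) = p` and `γ'(0) = v`, defined on an open interval which
contains `[0,1]`. (As `γ 0 = p`, the two tangent spaces `T_{γ(0)}M` and `T_pM` are identified with
`ℝⁿ` in the same way, through the preferred chart at `p`.) -/
def IsGeodesicFrom (g : SymmetricTensorField n M) (p : M) (v : TangentSpace (𝓡 n) p)
    (γ : ℝ → M) : Prop :=
  (∃ a b : ℝ, a < 0 ∧ 1 < b ∧ g.IsGeodesicOn γ (Ioo a b)) ∧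
  γ 0 = p ∧ (mfderiv 𝓘(ℝ, ℝ) (𝓡 n) γ 0 (1 : ℝ) : EuclideanSpace ℝ (Fin n)) = v

/-- The domain `𝒟 ∩ T_pM` of the exponential map at `p`: the vectors `v` for which the maximal
geodesic with initial velocity `v` is defined up to the parameter `1`. -/
def expDomain (g : SymmetricTensorField n M) (p : M) : Set (TangentSpace (𝓡 n) p) :=
  {v | ∃ γ : ℝ → M, g.IsGeodesicFrom p v γ}

open Classical in
/-- The exponential map `exp_p(v) = γ(1)`, where `γ` is the geodesic with initial velocity `v`
(on a Hausdorff manifold with a metric `γ` is unique on `[0,1]`), for `v ∈ g.expDomain p`; a junk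
value outside this domain. -/
def expMap (g : SymmetricTensorField n M) (p : M) (v : TangentSpace (𝓡 n) p) : M :=
  if h : ∃ γ : ℝ → M, g.IsGeodesicFrom p v γ then h.choose 1 else p

/-- `U` is a normal convex open set: `U` is open and, for every `q ∈ U`, there is a starshaped open
neighbourhood `V` of the origin of `T_qM`, contained in the domain of `exp_q`, such that
`exp_q : V → U` is a diffeomorphism. -/
def IsNormalConvex (g : SymmetricTensorField n M) (U : Set M) : Prop :=
  IsOpen U ∧ ∀ q ∈ U, ∃ V : Set (EuclideanSpace ℝ (Fin n)),
    IsOpen V ∧ 0 ∈ V ∧ StarConvex ℝ 0 V ∧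
    (∀ v ∈ V, (v : TangentSpace (𝓡 n) q) ∈ g.expDomain q) ∧
    ∃ Φ : PartialDiffeomorph (𝓡 n) (𝓡 n) (EuclideanSpace ℝ (Fin n)) M ∞,
      Φ.source = V ∧ Φ.target = U ∧ ∀ v ∈ V, Φ v = g.expMap q v

/-- `𝒞` is a strongly convex covering of `M`: a covering made of normal convex open sets whose
nonempty pairwise intersections are normal convex. -/
def IsStronglyConvexCovering (g : SymmetricTensorField n M) (𝒞 : Set (Set M)) : Prop :=
  ⋃₀ 𝒞 = univ ∧ (∀ C ∈ 𝒞, g.IsNormalConvex C) ∧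
    ∀ C ∈ 𝒞, ∀ C' ∈ 𝒞, (C ∩ C').Nonempty → g.IsNormalConvex (C ∩ C')

end SymmetricTensorField

end SemiRiemannian

end

/-!
# Strongly convex coverings of Riemannian and Lorentzian manifolds

The theorem rests on two facts.

*Whitehead's theorem* (`IsNondegenerate.exists_isNormalConvex`): each point has arbitrarily small
normal convex neighbourhoods. In a chart, geodesics are the solutions of `ẍ = -Γ(x)(ẋ, ẋ)`.
The time-one solution depends smoothly on its initial value `(q, v)` near the constant solution
`(p, 0)` (`exists_smooth_local_flow`), and `(q, v) ↦ (q, exp_q v)` has the invertible derivative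
`(a, b) ↦ (a, a + b)` there, so points near `p` are joined by a unique short geodesic, whose initial
velocity depends smoothly on the end points. As the squared coordinate distance to `p` is
convex along geodesics near `p`, such a geodesic does not leave a coordinate ball that contains its
end points, which makes small coordinate balls normal convex (`exists_convex_geodesic_ball`).

*Intersections* (`IsNormalConvex.inter`): if two normal convex sets lie in a common normal convex
set `U`, their intersection is normal convex. Indeed, for `q` in the intersection both starshaped
domains of `exp_q` are contained in the domain that belongs to `U`, on which `exp_q` is injective,
so `exp_q` maps the intersection of the two domains onto the intersection of the two sets.

Paracompactness provides a family of neighbourhoods `W x` in which two intersecting members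
always lie in a common normal convex set (`exists_nhds_subset_common`); the covering consists of
one normal convex neighbourhood of each point `x` inside `W x`.

The comparison of a chart computation with `expMap` needs that the geodesic equation does
not depend on the chart, which is read off from its Euler-Lagrange form
(`IsNondegenerate.geodesicEquation_change`), and that geodesics are determined by their initial
velocity (`IsNondegenerate.eqOn_of_isGeodesicOn`). Of the signature of the metric, only its
nondegeneracy is used.
-/

noncomputable section

open Topology

universe u

/-! ### Superposition operators on spaces of continuous curves -/

namespace ContinuousMap

variable {K : Type*} [TopologicalSpace K] [CompactSpace K]

set_option synthInstance.maxHeartbeats 200000 in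
/-- Pointwise application of a continuous family of continuous linear maps to a continuous map, as
a continuous linear map `C(K, E →L[ℝ] F) →L[ℝ] C(K, E) →L[ℝ] C(K, F)`. -/
def pointwiseApply (K : Type*) [TopologicalSpace K] [CompactSpace K]
    (E F : Type*) [NormedAddCommGroup E] [NormedSpace ℝ E]
    [NormedAddCommGroup F] [NormedSpace ℝ F] :
    C(K, E →L[ℝ] F) →L[ℝ] C(K, E) →L[ℝ] C(K, F) :=
  LinearMap.mkContinuous₂
    (LinearMap.mk₂ ℝ (fun (A : C(K, E →L[ℝ] F)) (h : C(K, E)) ↦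
      (⟨fun t ↦ A t (h t), by fun_prop⟩ : C(K, F)))
      (fun _ _ _ ↦ by ext; simp) (fun _ _ _ ↦ by ext; simp)
      (fun _ _ _ ↦ by ext; simp) (fun _ _ _ ↦ by ext; simp)) 1
    (fun A h ↦ by
      rw [ContinuousMap.norm_le _ (by positivity)]
      intro t
      calc ‖A t (h t)‖ ≤ ‖A t‖ * ‖h t‖ := (A t).le_opNorm _
        _ ≤ ‖A‖ * ‖h‖ := by gcongr <;> apply ContinuousMap.norm_coe_le_norm
        _ = 1 * ‖A‖ * ‖h‖ := by ring)

/-- The derivative of `β ↦ f ∘ β` at `α` is pointwise application of `f' ∘ α`. -/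
theorem hasFDerivAt_postcomp {E F : Type*} [NormedAddCommGroup E] [NormedSpace ℝ E]
    [NormedAddCommGroup F] [NormedSpace ℝ F] {f : C(E, F)} {f' : C(E, E →L[ℝ] F)}
    (hf : ∀ x, HasFDerivAt f (f' x) x) (α : C(K, E)) :
    HasFDerivAt (fun β : C(K, E) ↦ f.comp β) (pointwiseApply K E F (f'.comp α)) α := by
  rw [hasFDerivAt_iff_isLittleO_nhds_zero, Asymptotics.isLittleO_iff]
  intro c hc
  -- `f'` is uniformly continuous at the points of the compact range of `α`
  have hu := (isCompact_range α.continuous).uniformContinuousAt_of_continuousAt f'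
    (fun a _ ↦ f'.continuous.continuousAt) (Metric.dist_mem_uniformity hc)
  obtain ⟨δ, hδ, hδu⟩ := Metric.mem_uniformity_dist.1 hu
  filter_upwards [Metric.ball_mem_nhds (0 : C(K, E)) hδ] with h hh
  rw [ContinuousMap.norm_le _ (by positivity)]
  intro t
  have hht : ‖h t‖ < δ := (h.norm_coe_le_norm t).trans_lt (by simpa using hh)
  have key := (convex_ball (α t) δ).norm_image_sub_le_of_norm_hasFDerivWithin_le'
    (f := f) (f' := f') (φ := f' (α t)) (C := c) (x := α t) (y := α t + h t)
    (fun x _ ↦ (hf x).hasFDerivWithinAt)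
    (fun x hx ↦ by
      have := hδu (a := α t) (b := x) (by rw [dist_comm]; exact hx) (mem_range_self t)
      rw [← dist_eq_norm, dist_comm]
      exact le_of_lt this)
    (Metric.mem_ball_self hδ) (by simpa [mem_ball_iff_norm] using hht)
  simp only [add_sub_cancel_left] at key
  exact key.trans (by gcongr; exact h.norm_coe_le_norm t)

set_option synthInstance.maxHeartbeats 200000 in
theorem contDiff_nat_postcomp (n : ℕ) : ∀ {E F : Type u} [NormedAddCommGroup E] [NormedSpace ℝ E]
    [NormedAddCommGroup F] [NormedSpace ℝ F] {f : C(E, F)}, ContDiff ℝ n f →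
    ContDiff ℝ n (fun β : C(K, E) ↦ f.comp β) := by
  induction n with
  | zero =>
    intro E F _ _ _ _ f _
    exact contDiff_zero.2 (ContinuousMap.continuous_postcomp f)
  | succ n ih =>
    intro E F _ _ _ _ f hf
    obtain ⟨f', hf', hd⟩ := contDiff_succ_iff_hasFDerivAt.1 (by exact_mod_cast hf)
    have := ih (f := ⟨f', hf'.continuous⟩) hf'
    have h2 := contDiff_succ_iff_hasFDerivAt.2 ⟨_, (pointwiseApply K E F).contDiff.comp this,
      fun α ↦ hasFDerivAt_postcomp (f := f) (f' := ⟨f', hf'.continuous⟩) hd α⟩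
    exact_mod_cast h2

/-- Composition with a smooth map is a smooth operator between spaces of continuous maps on a
compact space. -/
theorem contDiff_postcomp {E F : Type u} [NormedAddCommGroup E] [NormedSpace ℝ E]
    [NormedAddCommGroup F] [NormedSpace ℝ F] {f : C(E, F)} (hf : ContDiff ℝ ∞ f) :
    ContDiff ℝ ∞ (fun β : C(K, E) ↦ f.comp β) :=
  contDiff_infty.2 fun n ↦ contDiff_nat_postcomp n (contDiff_infty.1 hf n)

/-- The primitive vanishing at `0`, as a continuous linear operator on curves over `[-1, 2]`, a
neighbourhood of the time interval `[0, 1]` of the exponential map. -/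
def primitive (E : Type*) [NormedAddCommGroup E] [NormedSpace ℝ E] [CompleteSpace E] :
    C(Icc (-1 : ℝ) 2, E) →L[ℝ] C(Icc (-1 : ℝ) 2, E) :=
  LinearMap.mkContinuous
    { toFun α := ⟨fun t ↦ ∫ s in (0 : ℝ)..t, IccExtend (by norm_num) α s,
        (intervalIntegral.continuous_primitive
          (fun _ _ ↦ (α.continuous.Icc_extend' (h := by norm_num)).intervalIntegrable _ _) 0).comp
          continuous_subtype_val⟩
      map_add' α β := by
        ext t
        exact intervalIntegral.integral_add
          ((α.continuous.Icc_extend' (h := by norm_num)).intervalIntegrable _ _)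
          ((β.continuous.Icc_extend' (h := by norm_num)).intervalIntegrable _ _)
      map_smul' c α := by
        ext t
        exact intervalIntegral.integral_smul c _ } 2
    (fun α ↦ by
      rw [ContinuousMap.norm_le _ (by positivity)]
      intro t
      refine (intervalIntegral.norm_integral_le_of_norm_le_const (C := ‖α‖)
        (fun x _ ↦ α.norm_coe_le_norm _)).trans ?_
      rw [mul_comm]
      gcongr
      rw [sub_zero, abs_le]
      constructor <;> linarith [t.2.1, t.2.2])

end ContinuousMap

/-- The inverse function theorem for a map that is smooth near a point, with an inverse that is
smooth on an open set. -/
theorem exists_openPartialHomeomorph_contDiffOn_symm {E F : Type*}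
    [NormedAddCommGroup E] [NormedSpace ℝ E] [CompleteSpace E]
    [NormedAddCommGroup F] [NormedSpace ℝ F] {f : E → F} {s : Set E} {a : E}
    (hs : IsOpen s) (ha : a ∈ s) (hf : ContDiffOn ℝ ∞ f s) {f' : E ≃L[ℝ] F}
    (hf' : HasFDerivAt f (f' : E →L[ℝ] F) a) :
    ∃ e : OpenPartialHomeomorph E F, a ∈ e.source ∧ e.source ⊆ s ∧ (∀ x, e x = f x) ∧
      ContDiffOn ℝ ∞ e.symm e.target := by
  have hfa : ContDiffAt ℝ ∞ f a := hf.contDiffAt (hs.mem_nhds ha)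
  have hn : (∞ : WithTop ℕ∞) ≠ 0 := by simp
  -- the derivative stays invertible near `a`
  have hopen : IsOpen (s ∩ fderiv ℝ f ⁻¹' range ((↑) : (E ≃L[ℝ] F) → E →L[ℝ] F)) :=
    (hf.continuousOn_fderiv_of_isOpen hs (by simp)).isOpen_inter_preimage hs
      ContinuousLinearEquiv.isOpen
  let e₀ := hfa.toOpenPartialHomeomorph f hf' hn
  refine ⟨e₀.restrOpen _ hopen,
    ⟨hfa.mem_toOpenPartialHomeomorph_source hf' hn, ha, f', hf'.fderiv.symm⟩,
    fun x hx ↦ hx.2.1, fun x ↦ rfl, ?_⟩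
  set e := e₀.restrOpen _ hopen
  intro y hy
  have hx : e.symm y ∈ e.source := e.map_target hy
  obtain ⟨f₁, hf₁⟩ := hx.2.2
  have hd : ContDiffAt ℝ ∞ f (e.symm y) := hf.contDiffAt (hs.mem_nhds hx.2.1)
  refine (e.contDiffAt_symm (f₀' := f₁) hy ?_ hd).contDiffWithinAt
  rw [hf₁]
  exact (hd.differentiableAt hn).hasFDerivAt

/-! ### The local flow of a second order equation -/

section Flow

variable {E : Type*} [NormedAddCommGroup E] [NormedSpace ℝ E]

/-- The vector field on `E × E` (positions and velocities) of the second order equation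
`ẍ = -Γ(x)(ẋ, ẋ)`. -/
def geodesicField (Γ : E → E →L[ℝ] E →L[ℝ] E) (z : E × E) : E × E :=
  (z.2, -Γ z.1 z.2 z.2)

theorem ContDiffAt.geodesicField {Γ : E → E →L[ℝ] E →L[ℝ] E} {n : WithTop ℕ∞} {z : E × E}
    (hΓ : ContDiffAt ℝ n Γ z.1) : ContDiffAt ℝ n (geodesicField Γ) z := by
  have h1 : ContDiffAt ℝ n (fun z : E × E ↦ Γ z.1) z := hΓ.comp z contDiffAt_fst
  exact contDiffAt_snd.prodMk ((h1.clm_apply contDiffAt_snd).clm_apply contDiffAt_snd).neg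

/-- The nilpotent endomorphism `(a, b) ↦ (b, 0)`, which is the derivative of the geodesic vector
field along the zero section. -/
def shiftMap (E : Type*) [NormedAddCommGroup E] [NormedSpace ℝ E] : E × E →L[ℝ] E × E :=
  (ContinuousLinearMap.snd ℝ E E).prod 0

set_option synthInstance.maxHeartbeats 200000 in
theorem hasFDerivAt_geodesicField_zero {Γ : E → E →L[ℝ] E →L[ℝ] E} {p : E}
    (hΓ : DifferentiableAt ℝ Γ p) :
    HasFDerivAt (geodesicField Γ) (shiftMap E) (p, 0) := by
  have h0 : HasFDerivAt (Prod.fst : E × E → E) (ContinuousLinearMap.fst ℝ E E) (p, (0 : E)) :=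
    hasFDerivAt_fst
  have h1 : HasFDerivAt (fun z : E × E ↦ Γ z.1) _ (p, (0 : E)) :=
    HasFDerivAt.comp (p, (0 : E)) (g := Γ) hΓ.hasFDerivAt h0
  have h2 := ((h1.clm_apply hasFDerivAt_snd).clm_apply hasFDerivAt_snd).neg
  refine (hasFDerivAt_snd.prodMk h2).congr_fderiv ?_
  ext <;> simp [shiftMap]

theorem primitive_compLeftContinuous [CompleteSpace E] (L : E →L[ℝ] E)
    (β : C(Icc (-1 : ℝ) 2, E)) :
    ContinuousMap.primitive E (L.compLeftContinuous ℝ _ β) =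
      L.compLeftContinuous ℝ _ (ContinuousMap.primitive E β) := by
  ext t
  exact L.intervalIntegral_comp_comm
    ((β.continuous.Icc_extend' (h := by norm_num)).intervalIntegrable _ _)

/-- The local flow `S` of the equation `ẍ = -Γ(x)(ẋ, ẋ)` near a point of rest `(p, 0)`: solutions
exist on `(-1, 2)`, stay close to `(p, 0)`, and depend smoothly on the initial value. At `(p, 0)` the
time-one position has derivative `(a, b) ↦ a + b`.

A solution with initial value `z` is a solution `α` of `α - ∫ X ∘ α = z` in the Banach space of
continuous curves. The left side is a smooth function of `α`, and its derivative at the constant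
curve is `1 - N` with `N² = 0`, so the inverse function theorem applies. -/
theorem exists_smooth_local_flow [CompleteSpace E] {Γ : E → E →L[ℝ] E →L[ℝ] E}
    (hΓ : ContDiff ℝ ∞ Γ) (p : E) :
    ∃ (Ω : Set (E × E)) (S : E × E → ℝ → E × E), IsOpen Ω ∧ (p, 0) ∈ Ω ∧
      (∀ z ∈ Ω, S z 0 = z) ∧
      (∀ z ∈ Ω, ∀ t ∈ Ioo (-1 : ℝ) 2, HasDerivAt (S z) (geodesicField Γ (S z t)) t) ∧
      ContDiffOn ℝ ∞ (fun z ↦ S z 1) Ω ∧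
      HasFDerivAt (fun z ↦ (S z 1).1)
        (ContinuousLinearMap.fst ℝ E E + ContinuousLinearMap.snd ℝ E E) (p, 0) ∧
      ∀ V ∈ 𝓝 ((p, 0) : E × E), ∀ᶠ z in 𝓝 ((p, 0) : E × E), ∀ t ∈ Icc (-1 : ℝ) 2, S z t ∈ V := by
  have hX : ContDiff ℝ ∞ (geodesicField Γ) :=
    contDiff_iff_contDiffAt.2 fun z ↦ hΓ.contDiffAt.geodesicField
  let X : C(E × E, E × E) := ⟨geodesicField Γ, hX.continuous⟩
  let K := Icc (-1 : ℝ) 2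
  let P := ContinuousMap.primitive (E × E)
  let G : C(K, E × E) → C(K, E × E) := fun α ↦ α - P (X.comp α)
  have hG : ContDiff ℝ ∞ G :=
    contDiff_id.sub (P.contDiff.comp (ContinuousMap.contDiff_postcomp (f := X) hX))
  let cst : E × E →L[ℝ] C(K, E × E) := ContinuousLinearMap.const ℝ K
  let α₀ : C(K, E × E) := cst (p, 0)
  have hXp : X (p, 0) = 0 := by simp [X, geodesicField]
  have hGα₀ : G α₀ = α₀ := by
    have : X.comp α₀ = 0 := by
      ext1 t
      exact hXp
    simp [G, this]
  let Lc := (shiftMap E).compLeftContinuous ℝ K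
  let N : C(K, E × E) →L[ℝ] C(K, E × E) := P.comp Lc
  have hNN : ∀ β, N (N β) = 0 := by
    intro β
    have : Lc (Lc β) = 0 := by
      ext t <;> simp [Lc, shiftMap]
    change P (Lc (P (Lc β))) = 0
    rw [← primitive_compLeftContinuous, this, map_zero, map_zero]
  let G' : C(K, E × E) ≃L[ℝ] C(K, E × E) := ContinuousLinearEquiv.equivOfInverse
    (ContinuousLinearMap.id ℝ _ - N) (ContinuousLinearMap.id ℝ _ + N)
    (fun β ↦ by simp [hNN]) (fun β ↦ by simp [hNN])
  have hG' : HasFDerivAt G (G' : C(K, E × E) →L[ℝ] C(K, E × E)) α₀ := by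
    let X' : C(E × E, E × E →L[ℝ] E × E) := ⟨fderiv ℝ X, hX.continuous_fderiv (by simp)⟩
    have h1 := ContinuousMap.hasFDerivAt_postcomp (K := K) (f := X) (f' := X')
      (fun x ↦ (hX.differentiable (by simp) x).hasFDerivAt) α₀
    refine ((hasFDerivAt_id α₀).sub (P.hasFDerivAt.comp α₀ h1)).congr_fderiv ?_
    ext1 β
    change β - P _ = β - P _
    congr 2
    ext1 t
    change fderiv ℝ (geodesicField Γ) (p, 0) (β t) = shiftMap E (β t)
    rw [(hasFDerivAt_geodesicField_zero (hΓ.differentiable (by simp) p)).fderiv]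
  obtain ⟨e, he₀, -, he, hes⟩ := exists_openPartialHomeomorph_contDiffOn_symm isOpen_univ
    (mem_univ α₀) hG.contDiffOn hG'
  have hα₀ : α₀ ∈ e.target := by
    have := e.map_source he₀
    rwa [he, hGα₀] at this
  have heα₀ : e.symm α₀ = α₀ := by
    have := e.left_inv he₀
    rwa [he, hGα₀] at this
  let S : E × E → ℝ → E × E := fun z t ↦
    z + ∫ s in (0 : ℝ)..t, IccExtend (by norm_num) (X.comp (e.symm (cst z))) s
  have hS : ∀ z, cst z ∈ e.target → ∀ t : K, e.symm (cst z) t = S z t := by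
    intro z hz t
    have h1 : G (e.symm (cst z)) = cst z := by rw [← he, e.right_inv hz]
    have h2 : e.symm (cst z) t - P (X.comp (e.symm (cst z))) t = z :=
      congrArg (fun γ : C(K, E × E) ↦ γ t) h1
    exact (sub_eq_iff_eq_add.1 h2)
  have h1K : (1 : ℝ) ∈ K := by constructor <;> norm_num
  let ev : C(K, E × E) →L[ℝ] E × E := ContinuousMap.evalCLM ℝ ⟨1, h1K⟩
  have hΩ : IsOpen (cst ⁻¹' e.target) := e.open_target.preimage cst.continuous
  refine ⟨cst ⁻¹' e.target, S, hΩ, hα₀, ?_, ?_, ?_, ?_, ?_⟩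
  · intro z _
    simp [S]
  · intro z hz t ht
    have hc : Continuous (IccExtend (by norm_num : (-1 : ℝ) ≤ 2) (X.comp (e.symm (cst z)))) :=
      (ContinuousMap.continuous _).Icc_extend'
    have h1 := (intervalIntegral.integral_hasDerivAt_right (hc.intervalIntegrable 0 t)
      (hc.stronglyMeasurableAtFilter _ _) hc.continuousAt).const_add z
    refine h1.congr_deriv ?_
    have htK : t ∈ Icc (-1 : ℝ) 2 := Ioo_subset_Icc_self ht
    rw [IccExtend_of_mem _ _ htK]
    change geodesicField Γ (e.symm (cst z) ⟨t, htK⟩) = _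
    rw [hS z hz]
  · have h1 : ContDiffOn ℝ ∞ (fun z ↦ ev (e.symm (cst z))) (cst ⁻¹' e.target) :=
      ev.contDiff.comp_contDiffOn (hes.comp cst.contDiff.contDiffOn fun z hz ↦ hz)
    exact h1.congr fun z hz ↦ (hS z hz ⟨1, h1K⟩).symm
  · have h1 : HasFDerivAt e (G' : C(K, E × E) →L[ℝ] C(K, E × E)) (e.symm α₀) := by
      rw [heα₀]
      exact hG'.congr_of_eventuallyEq (Filter.Eventually.of_forall he)
    have h2 := e.hasFDerivAt_symm hα₀ h1
    have h3 : HasFDerivAt (fun z ↦ ev (e.symm (cst z))) _ (p, (0 : E)) :=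
      (ev.hasFDerivAt.comp _ (HasFDerivAt.comp (p, (0 : E)) (g := e.symm) h2 cst.hasFDerivAt))
    have h4 := (hasFDerivAt_fst (𝕜 := ℝ) (E := E) (F := E)).comp _ h3
    refine (h4.congr_of_eventuallyEq ?_).congr_fderiv ?_
    · filter_upwards [hΩ.mem_nhds hα₀] with z hz
      exact congrArg Prod.fst (hS z hz ⟨1, h1K⟩).symm
    · refine ContinuousLinearMap.ext fun v ↦ ?_
      have hN : N (cst v) ⟨1, h1K⟩ = (v.2, 0) := by
        change ∫ s in (0 : ℝ)..1, IccExtend _ (Lc (cst v)) s = _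
        have : (fun s ↦ IccExtend (by norm_num : (-1 : ℝ) ≤ 2) (Lc (cst v)) s) =
            fun _ ↦ (v.2, (0 : E)) := rfl
        rw [this]
        simp
      change (cst v ⟨1, h1K⟩ + N (cst v) ⟨1, h1K⟩).1 = v.1 + v.2
      rw [hN]
      rfl
  · intro V hV
    obtain ⟨ε, hε, hεV⟩ := Metric.mem_nhds_iff.1 hV
    have hcont : ContinuousAt (fun z ↦ e.symm (cst z)) (p, (0 : E)) :=
      ContinuousAt.comp (g := e.symm) (e.continuousAt_symm hα₀) cst.continuous.continuousAt
    have h1 : ∀ᶠ z in 𝓝 ((p, 0) : E × E), dist (e.symm (cst z)) α₀ < ε := by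
      have := hcont.eventually (Metric.ball_mem_nhds _ hε)
      simpa [show cst (p, (0 : E)) = α₀ from rfl, heα₀] using this
    filter_upwards [h1, hΩ.mem_nhds hα₀] with z hz hzΩ t ht
    apply hεV
    rw [← hS z hzΩ ⟨t, ht⟩]
    exact (ContinuousMap.dist_apply_le_dist (f := e.symm (cst z)) (g := α₀) ⟨t, ht⟩).trans_lt hz

end Flow

/-! ### Small convex balls for a second order equation -/

section ConvexBall

variable {E : Type*} [NormedAddCommGroup E] [InnerProductSpace ℝ E]

/-- Along a solution of `ẍ = -Γ(x)(ẋ, ẋ)` near `p`, the squared Euclidean distance to `p` is a convex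
function of time, as its second derivative `2(‖ẋ‖² - ⟪x - p, Γ(x)(ẋ, ẋ)⟫)` is nonnegative. -/
theorem convexOn_sq_norm_sub_of_geodesicField {Γ : E → E →L[ℝ] E →L[ℝ] E} {z : ℝ → E × E} {p : E}
    {J : Set ℝ} (hJ : Convex ℝ J)
    (hz : ∀ t ∈ J, HasDerivAt z (geodesicField Γ (z t)) t)
    (hsmall : ∀ t ∈ J, ‖(z t).1 - p‖ * ‖Γ (z t).1‖ ≤ 1) :
    ConvexOn ℝ J fun t ↦ ‖(z t).1 - p‖ ^ 2 := by
  have h1 : ∀ t ∈ J, HasDerivAt (fun t ↦ (z t).1 - p) (z t).2 t := fun t ht ↦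
    ((hz t ht).fst).sub_const p
  have h2 : ∀ t ∈ J, HasDerivAt (fun t ↦ (z t).2) (-Γ (z t).1 (z t).2 (z t).2) t := fun t ht ↦
    (hz t ht).snd
  have h3 : ∀ t ∈ J, HasDerivAt (fun t ↦ ‖(z t).1 - p‖ ^ 2)
      (2 * inner ℝ ((z t).1 - p) (z t).2) t := fun t ht ↦ (h1 t ht).norm_sq
  have h4 : ∀ t ∈ J, HasDerivAt (fun t ↦ 2 * inner ℝ ((z t).1 - p) (z t).2)
      (2 * (inner ℝ ((z t).1 - p) (-Γ (z t).1 (z t).2 (z t).2) + inner ℝ (z t).2 (z t).2)) t :=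
    fun t ht ↦ ((h1 t ht).inner ℝ (h2 t ht)).const_mul 2
  refine convexOn_of_hasDerivWithinAt2_nonneg hJ
    (fun t ht ↦ (h3 t ht).continuousAt.continuousWithinAt)
    (fun t ht ↦ (h3 t (interior_subset ht)).hasDerivWithinAt)
    (fun t ht ↦ (h4 t (interior_subset ht)).hasDerivWithinAt) ?_
  intro t ht
  replace ht := interior_subset ht
  rw [inner_neg_right, real_inner_self_eq_norm_sq]
  have h5 : inner ℝ ((z t).1 - p) (Γ (z t).1 (z t).2 (z t).2) ≤ ‖(z t).2‖ ^ 2 :=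
    calc _ ≤ ‖(z t).1 - p‖ * ‖Γ (z t).1 (z t).2 (z t).2‖ := real_inner_le_norm _ _
      _ ≤ ‖(z t).1 - p‖ * (‖Γ (z t).1‖ * ‖(z t).2‖ * ‖(z t).2‖) := by
        gcongr
        exact (Γ (z t).1).le_opNorm₂ _ _
      _ = (‖(z t).1 - p‖ * ‖Γ (z t).1‖) * ‖(z t).2‖ ^ 2 := by ring
      _ ≤ 1 * ‖(z t).2‖ ^ 2 := by gcongr; exact hsmall t ht
      _ = _ := one_mul _
  linarith

set_option synthInstance.maxHeartbeats 200000 in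
/-- Whitehead's theorem for the equation `ẍ = -Γ(x)(ẋ, ẋ)`: with `S` the local flow, the points of
a small ball `B` around `p` are joined by exactly one solution with small initial velocity,
this solution stays in `B`, and its initial velocity `R (q, r)` is a smooth function of its end
points. -/
theorem exists_convex_geodesic_ball [CompleteSpace E] {Γ : E → E →L[ℝ] E →L[ℝ] E}
    (hΓ : ContDiff ℝ ∞ Γ) (p : E) {ρ : ℝ} (hρ : 0 < ρ) :
    ∃ (δ ε : ℝ) (S : E × E → ℝ → E × E) (R : E × E → E), 0 < δ ∧ 0 < ε ∧ δ ≤ ρ ∧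
      (∀ q ∈ Metric.ball p δ, ∀ v ∈ Metric.ball (0 : E) ε,
        S (q, v) 0 = (q, v) ∧
        (∀ t ∈ Ioo (-1 : ℝ) 2, HasDerivAt (S (q, v)) (geodesicField Γ (S (q, v) t)) t) ∧
        (∀ t ∈ Icc (-1 : ℝ) 2, (S (q, v) t).1 ∈ Metric.ball p ρ) ∧
        ((S (q, v) 1).1 ∈ Metric.ball p δ →
          (∀ t ∈ Icc (0 : ℝ) 1, (S (q, v) t).1 ∈ Metric.ball p δ) ∧
          R (q, (S (q, v) 1).1) = v)) ∧
      ContDiffOn ℝ ∞ (fun z ↦ (S z 1).1) (Metric.ball p δ ×ˢ Metric.ball 0 ε) ∧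
      ContDiffOn ℝ ∞ R (Metric.ball p δ ×ˢ Metric.ball p δ) ∧
      ∀ q ∈ Metric.ball p δ, ∀ r ∈ Metric.ball p δ,
        R (q, r) ∈ Metric.ball (0 : E) ε ∧ (S (q, R (q, r)) 1).1 = r := by
  obtain ⟨Ω, S, hΩ, hpΩ, hS0, hSd, hSs, hS', hSV⟩ := exists_smooth_local_flow hΓ p
  -- a radius below which the squared distance to `p` is convex along solutions
  obtain ⟨ρ', hρ'0, hρ'ρ, hρ'⟩ : ∃ ρ' > 0, ρ' ≤ ρ ∧
      ∀ x ∈ Metric.ball p ρ', ‖x - p‖ * ‖Γ x‖ ≤ 1 := by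
    have hc : Continuous fun x ↦ ‖x - p‖ * ‖Γ x‖ :=
      (continuous_id.sub continuous_const).norm.mul
        ((continuous_norm (E := E →L[ℝ] E →L[ℝ] E)).comp hΓ.continuous)
    have : ∀ᶠ x in 𝓝 p, ‖x - p‖ * ‖Γ x‖ ≤ 1 :=
      (hc.tendsto p).eventually (Iic_mem_nhds (by simp))
    obtain ⟨r, hr, h⟩ := Metric.eventually_nhds_iff_ball.1 this
    exact ⟨min r ρ, lt_min hr hρ, min_le_right _ _,
      fun x hx ↦ h x (Metric.ball_subset_ball (min_le_left _ _) hx)⟩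
  have hSp : S (p, 0) 1 = (p, 0) := by
    by_contra hne
    exact (hSV _ (isOpen_ne.mem_nhds (Ne.symm hne))).self_of_nhds 1
      (by constructor <;> norm_num) rfl
  have hV : Metric.ball p ρ' ×ˢ (univ : Set E) ∈ 𝓝 ((p, 0) : E × E) :=
    prod_mem_nhds (Metric.ball_mem_nhds _ hρ'0) Filter.univ_mem
  obtain ⟨W, hWV, hWo, hpW⟩ := mem_nhds_iff.1 (hSV _ hV)
  let f : E × E → E × E := fun z ↦ (z.1, (S z 1).1)
  have hfst : ContDiffOn ℝ ∞ (fun z ↦ (S z 1).1) Ω := contDiff_fst.comp_contDiffOn hSs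
  have hf : ContDiffOn ℝ ∞ f Ω := contDiff_fst.contDiffOn.prodMk hfst
  let f' : (E × E) ≃L[ℝ] E × E := ContinuousLinearEquiv.equivOfInverse
    ((ContinuousLinearMap.fst ℝ E E).prod
      (ContinuousLinearMap.fst ℝ E E + ContinuousLinearMap.snd ℝ E E))
    ((ContinuousLinearMap.fst ℝ E E).prod
      (ContinuousLinearMap.snd ℝ E E - ContinuousLinearMap.fst ℝ E E))
    (fun v ↦ by simp) (fun v ↦ by simp)
  have hf' : HasFDerivAt f (f' : E × E →L[ℝ] E × E) (p, 0) := hasFDerivAt_fst.prodMk hS'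
  obtain ⟨e, hpe, heΩ, hef, hes⟩ := exists_openPartialHomeomorph_contDiffOn_symm
    (hΩ.inter hWo) ⟨hpΩ, hpW⟩ (hf.mono inter_subset_left) hf'
  obtain ⟨ε, hε, hεe⟩ := Metric.isOpen_iff.1 e.open_source _ hpe
  have himo : IsOpen (e '' Metric.ball (p, 0) ε) :=
    e.isOpen_image_of_subset_source Metric.isOpen_ball hεe
  have hpp : (p, p) ∈ e '' Metric.ball (p, 0) ε :=
    ⟨(p, 0), Metric.mem_ball_self hε, by rw [hef]; simp [f, hSp]⟩
  obtain ⟨δ', hδ', hδe⟩ := Metric.isOpen_iff.1 himo _ hpp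
  obtain ⟨δ, hδ, hδδ', hδρ', hδε⟩ : ∃ δ > 0, δ ≤ δ' ∧ δ ≤ ρ' ∧ δ ≤ ε :=
    ⟨min δ' (min ρ' ε), by positivity, min_le_left _ _,
      (min_le_right _ _).trans (min_le_left _ _), (min_le_right _ _).trans (min_le_right _ _)⟩
  rw [← ball_prod_same] at hεe hδe
  have hsub : Metric.ball p δ ×ˢ Metric.ball 0 ε ⊆ e.source :=
    (prod_mono (Metric.ball_subset_ball hδε) subset_rfl).trans hεe
  have hBB : Metric.ball p δ ×ˢ Metric.ball p δ ⊆ e '' (Metric.ball p ε ×ˢ Metric.ball 0 ε) := by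
    rw [ball_prod_same p 0 ε]
    exact (prod_mono (Metric.ball_subset_ball hδδ') (Metric.ball_subset_ball hδδ')).trans hδe
  have htar : Metric.ball p δ ×ˢ Metric.ball p δ ⊆ e.target := by
    refine hBB.trans ?_
    rintro _ ⟨z, hz, rfl⟩
    exact e.map_source (hεe hz)
  refine ⟨δ, ε, S, fun z ↦ (e.symm z).2, hδ, hε, hδρ'.trans hρ'ρ, ?_, ?_, ?_, ?_⟩
  · intro q hq v hv
    have hz : (q, v) ∈ e.source := hsub ⟨hq, hv⟩
    have hzΩ := (heΩ hz).1
    have hzρ : ∀ t ∈ Icc (-1 : ℝ) 2, (S (q, v) t).1 ∈ Metric.ball p ρ' :=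
      fun t ht ↦ (hWV (heΩ hz).2 t ht).1
    refine ⟨hS0 _ hzΩ, hSd _ hzΩ, fun t ht ↦ Metric.ball_subset_ball hρ'ρ (hzρ t ht),
      fun h1 ↦ ⟨?_, ?_⟩⟩
    · have hconv := convexOn_sq_norm_sub_of_geodesicField (convex_Ioo (-1 : ℝ) 2)
        (hSd _ hzΩ) (fun t ht ↦ hρ' _ (hzρ t (Ioo_subset_Icc_self ht)))
      intro t ht
      have hseg : t ∈ segment ℝ (0 : ℝ) 1 := by rwa [segment_eq_Icc zero_le_one]
      have hmax := hconv.le_on_segment (x := 0) (y := 1) (by norm_num) (by norm_num) hseg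
      have h0 : ‖(S (q, v) 0).1 - p‖ ^ 2 < δ ^ 2 := by
        rw [hS0 _ hzΩ]
        have := mem_ball_iff_norm.1 hq
        gcongr
      have h1' : ‖(S (q, v) 1).1 - p‖ ^ 2 < δ ^ 2 := by
        have := mem_ball_iff_norm.1 h1
        gcongr
      rw [mem_ball_iff_norm]
      exact lt_of_pow_lt_pow_left₀ 2 hδ.le (hmax.trans_lt (max_lt h0 h1'))
    · have := e.left_inv hz
      rw [hef] at this
      exact congrArg Prod.snd this
  · exact hfst.mono fun z hz ↦ (heΩ (hsub hz)).1
  · exact contDiff_snd.comp_contDiffOn (hes.mono htar)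
  · intro q hq r hr
    obtain ⟨z, hz, hzqr⟩ := hBB (mk_mem_prod hq hr)
    have hsymm : e.symm (q, r) = z := by rw [← hzqr, e.left_inv (hεe hz)]
    rw [hef] at hzqr
    have h1 : z.1 = q := congrArg Prod.fst hzqr
    have h2 : (S z 1).1 = r := congrArg Prod.snd hzqr
    simp only [hsymm]
    refine ⟨hz.2, ?_⟩
    rw [← h1]
    exact h2

end ConvexBall

/-! ### The geodesic equation as an Euler-Lagrange equation -/

section EulerLagrange

variable {E : Type*} [NormedAddCommGroup E] [NormedSpace ℝ E]

/-- The Euler-Lagrange covector of the energy `½ G(ẋ, ẋ)` at the point `y`, for the velocity `u` and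
the acceleration `a`, evaluated on `w`. -/
def eulerLagrange (G : E → E →L[ℝ] E →L[ℝ] ℝ) (y u a w : E) : ℝ :=
  G y a w + fderiv ℝ G y u u w - (1 / 2 : ℝ) * fderiv ℝ G y w u u

set_option synthInstance.maxHeartbeats 200000 in
/-- The Euler-Lagrange covector is natural under a change of coordinates `ψ`; the acceleration
changes by the second derivative of `ψ`. -/
theorem eulerLagrange_pullback {G G' : E → E →L[ℝ] E →L[ℝ] ℝ} {ψ : E → E} {y : E}
    (hψ : ContDiffAt ℝ 2 ψ y) (hG : DifferentiableAt ℝ G y) (hG' : DifferentiableAt ℝ G' (ψ y))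
    (hsymm : ∀ v w, G' (ψ y) v w = G' (ψ y) w v)
    (h : ∀ᶠ z in 𝓝 y, ∀ v w, G z v w = G' (ψ z) (fderiv ℝ ψ z v) (fderiv ℝ ψ z w)) (u a w : E) :
    eulerLagrange G y u a w = eulerLagrange G' (ψ y) (fderiv ℝ ψ y u)
      (fderiv ℝ ψ y a + fderiv ℝ (fderiv ℝ ψ) y u u) (fderiv ℝ ψ y w) := by
  have hd : DifferentiableAt ℝ (fderiv ℝ ψ) y :=
    (hψ.fderiv_right (m := 1) (by norm_num [one_add_one_eq_two])).differentiableAt (by simp)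
  have hψd : DifferentiableAt ℝ ψ y := hψ.differentiableAt (by simp)
  have hs : ∀ v v', fderiv ℝ (fderiv ℝ ψ) y v v' = fderiv ℝ (fderiv ℝ ψ) y v' v := fun v v' ↦
    (hψ.isSymmSndFDerivAt (by simp)) v v'
  have key : ∀ u v w, fderiv ℝ G y u v w =
      fderiv ℝ G' (ψ y) (fderiv ℝ ψ y u) (fderiv ℝ ψ y v) (fderiv ℝ ψ y w) +
      G' (ψ y) (fderiv ℝ (fderiv ℝ ψ) y u v) (fderiv ℝ ψ y w) +
      G' (ψ y) (fderiv ℝ ψ y v) (fderiv ℝ (fderiv ℝ ψ) y u w) := by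
    intro u v w
    have h1 : HasFDerivAt (fun z ↦ G z v w) _ y :=
      (hG.hasFDerivAt.clm_apply (hasFDerivAt_const v y)).clm_apply (hasFDerivAt_const w y)
    have h2 : HasFDerivAt (fun z ↦ G' (ψ z)) _ y :=
      HasFDerivAt.comp (g := G') y hG'.hasFDerivAt hψd.hasFDerivAt
    have h3 : ∀ v, HasFDerivAt (fun z ↦ fderiv ℝ ψ z v) _ y := fun v ↦
      hd.hasFDerivAt.clm_apply (hasFDerivAt_const v y)
    have h4 := (h2.clm_apply (h3 v)).clm_apply (h3 w)
    have h5 := h1.unique (h4.congr_of_eventuallyEq (h.mono fun z hz ↦ hz v w))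
    have h6 := congrArg (fun L : E →L[ℝ] ℝ ↦ L u) h5
    simp at h6
    rw [h6]
    ring
  unfold eulerLagrange
  rw [h.self_of_nhds, key, key, map_add, add_apply, hs w u, hsymm _ (fderiv ℝ ψ y u)]
  ring

theorem deriv_comp_eventuallyEq {x : ℝ → E} {ψ : E → E} {t : ℝ}
    (hx : ContDiffAt ℝ 2 x t) (hψ : ContDiffAt ℝ 2 ψ (x t)) :
    deriv (fun s ↦ ψ (x s)) =ᶠ[𝓝 t] fun s ↦ fderiv ℝ ψ (x s) (deriv x s) := by
  filter_upwards [hx.eventually (by simp), hx.continuousAt.eventually (hψ.eventually (by simp))]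
    with s h1 h2
  exact fderiv_comp_deriv s (h2.differentiableAt (by simp)) (h1.differentiableAt (by simp))

theorem deriv_deriv_comp {x : ℝ → E} {ψ : E → E} {t : ℝ}
    (hx : ContDiffAt ℝ 2 x t) (hψ : ContDiffAt ℝ 2 ψ (x t)) :
    deriv (deriv fun s ↦ ψ (x s)) t = fderiv ℝ ψ (x t) (deriv (deriv x) t) +
      fderiv ℝ (fderiv ℝ ψ) (x t) (deriv x t) (deriv x t) := by
  rw [(deriv_comp_eventuallyEq hx hψ).deriv_eq]
  have hd : DifferentiableAt ℝ (fderiv ℝ ψ) (x t) :=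
    (hψ.fderiv_right (m := 1) (by norm_num [one_add_one_eq_two])).differentiableAt (by simp)
  have h1 : HasDerivAt (fun s ↦ fderiv ℝ ψ (x s)) _ t :=
    hd.hasFDerivAt.comp_hasDerivAt t (hx.differentiableAt (by simp)).hasDerivAt
  have h2 : DifferentiableAt ℝ (deriv x) t :=
    ((hx.fderiv_right (m := 1) (by norm_num [one_add_one_eq_two])).differentiableAt
      (by simp)).clm_apply (differentiableAt_const 1)
  rw [(h1.clm_apply h2.hasDerivAt).deriv, add_comm]

end EulerLagrange

theorem EuclideanSpace.sum_smul_single {n : ℕ} (v : EuclideanSpace ℝ (Fin n)) :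
    ∑ i, v i • EuclideanSpace.single i (1 : ℝ) = v := by
  simpa using (EuclideanSpace.basisFun (Fin n) ℝ).sum_repr v

/-- The bilinear map `(v, w) ↦ v_i w_j c`. -/
def EuclideanSpace.basisBilin {n : ℕ} {F : Type*} [NormedAddCommGroup F] [NormedSpace ℝ F]
    (i j : Fin n) (c : F) :
    EuclideanSpace ℝ (Fin n) →L[ℝ] EuclideanSpace ℝ (Fin n) →L[ℝ] F :=
  (EuclideanSpace.proj i : EuclideanSpace ℝ (Fin n) →L[ℝ] ℝ).smulRight
    ((EuclideanSpace.proj j : EuclideanSpace ℝ (Fin n) →L[ℝ] ℝ).smulRight c)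

theorem EuclideanSpace.basisBilin_apply {n : ℕ} {F : Type*} [NormedAddCommGroup F]
    [NormedSpace ℝ F] (i j : Fin n) (c : F) (v w : EuclideanSpace ℝ (Fin n)) :
    EuclideanSpace.basisBilin i j c v w = v i • w j • c := rfl

theorem ContDiffOn.smul_fixed {E F : Type*} [NormedAddCommGroup E] [NormedSpace ℝ E]
    [NormedAddCommGroup F] [NormedSpace ℝ F] {f : E → ℝ} {s : Set E} {m : WithTop ℕ∞}
    (hf : ContDiffOn ℝ m f s) (c : F) : ContDiffOn ℝ m (fun x ↦ f x • c) s :=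
  hf.smul contDiffOn_const

/-- A bilinear map is determined by its values on the standard basis. -/
theorem EuclideanSpace.bilin_apply_eq_sum {n : ℕ} {F : Type*} [NormedAddCommGroup F]
    [NormedSpace ℝ F] (T : EuclideanSpace ℝ (Fin n) →L[ℝ] EuclideanSpace ℝ (Fin n) →L[ℝ] F)
    (v w : EuclideanSpace ℝ (Fin n)) :
    T v w = ∑ i, ∑ j, (v i * w j) • T (EuclideanSpace.single i 1) (EuclideanSpace.single j 1) := by
  conv_lhs => rw [← EuclideanSpace.sum_smul_single v, ← EuclideanSpace.sum_smul_single w]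
  simp only [map_sum, map_smul, sum_apply, smul_apply, Finset.smul_sum,
    smul_smul]
  rw [Finset.sum_comm]
  simp only [mul_comm]

/-! ### The metric and the Christoffel symbols in a chart -/

theorem mdifferentiable_of_mem_maximalAtlas {n : ℕ} {M : Type*} [TopologicalSpace M]
    [ChartedSpace (EuclideanSpace ℝ (Fin n)) M]
    {φ : OpenPartialHomeomorph M (EuclideanSpace ℝ (Fin n))}
    (hφ : φ ∈ IsManifold.maximalAtlas (𝓡 n) ∞ M) : φ.MDifferentiable (𝓡 n) (𝓡 n) :=
  ⟨(contMDiffOn_of_mem_maximalAtlas hφ).mdifferentiableOn (by simp),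
    (contMDiffOn_symm_of_mem_maximalAtlas hφ).mdifferentiableOn (by simp)⟩

namespace SemiRiemannian

variable {n : ℕ} {M : Type*} [TopologicalSpace M]
  [ChartedSpace (EuclideanSpace ℝ (Fin n)) M] [IsManifold (𝓡 n) ∞ M]

namespace SymmetricTensorField

variable (g : SymmetricTensorField n M)

/-- `g` is nondegenerate at every point. -/
def IsNondegenerate : Prop :=
  ∀ (p : M) (v : TangentSpace (𝓡 n) p), (∀ w, g.form p v w = 0) → v = 0

variable {g} in
theorem IsRiemannian.isNondegenerate (hg : g.IsRiemannian) : g.IsNondegenerate := by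
  intro p v hv
  by_contra hne
  exact (hg p v hne).ne' (hv v)

variable {g} in
theorem IsLorentzian.isNondegenerate (hg : g.IsLorentzian) : g.IsNondegenerate := by
  intro p v hv
  by_contra hne
  -- a vector `v` in the kernel is orthogonal to the timelike vector `u`, so `g(v, v) > 0`
  obtain ⟨u, -, hu⟩ := hg p
  exact (hu v (by rw [g.symm, hv]) hne).ne' (hv v)

/-- The matrix `g_{ij}(y)` of `g` in the chart `φ`, as a bilinear form on `ℝⁿ`. -/
def coordForm (φ : OpenPartialHomeomorph M (EuclideanSpace ℝ (Fin n)))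
    (y : EuclideanSpace ℝ (Fin n)) :
    EuclideanSpace ℝ (Fin n) →L[ℝ] EuclideanSpace ℝ (Fin n) →L[ℝ] ℝ :=
  ∑ i, ∑ j, g.coordMatrix φ y i j • EuclideanSpace.basisBilin i j (1 : ℝ)

theorem coordForm_apply (φ : OpenPartialHomeomorph M (EuclideanSpace ℝ (Fin n)))
    (y v w : EuclideanSpace ℝ (Fin n)) :
    g.coordForm φ y v w = g.form (φ.symm y) (mfderiv (𝓡 n) (𝓡 n) φ.symm y v)
      (mfderiv (𝓡 n) (𝓡 n) φ.symm y w) := by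
  let D : EuclideanSpace ℝ (Fin n) →L[ℝ] EuclideanSpace ℝ (Fin n) :=
    mfderiv (𝓡 n) (𝓡 n) φ.symm y
  let B : EuclideanSpace ℝ (Fin n) →L[ℝ] EuclideanSpace ℝ (Fin n) →L[ℝ] ℝ := g.form (φ.symm y)
  refine Eq.trans ?_ (EuclideanSpace.bilin_apply_eq_sum (B.bilinearComp D D) v w).symm
  simp only [coordForm, sum_apply, smul_apply, EuclideanSpace.basisBilin_apply, smul_eq_mul]
  refine Finset.sum_congr rfl fun i _ ↦ Finset.sum_congr rfl fun j _ ↦ ?_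
  change _ = v i * w j * g.coordMatrix φ y i j
  ring

theorem coordForm_single (φ : OpenPartialHomeomorph M (EuclideanSpace ℝ (Fin n)))
    (y : EuclideanSpace ℝ (Fin n)) (i j : Fin n) :
    g.coordForm φ y (EuclideanSpace.single i 1) (EuclideanSpace.single j 1) =
      g.coordMatrix φ y i j :=
  g.coordForm_apply φ y _ _

theorem coordForm_symm (φ : OpenPartialHomeomorph M (EuclideanSpace ℝ (Fin n)))
    (y v w : EuclideanSpace ℝ (Fin n)) : g.coordForm φ y v w = g.coordForm φ y w v := by
  rw [coordForm_apply, coordForm_apply, g.symm]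

variable {φ : OpenPartialHomeomorph M (EuclideanSpace ℝ (Fin n))}

/-- The coordinate vector fields of a chart are smooth. -/
theorem contMDiffOn_mfderiv_symm_apply (hφ : φ ∈ IsManifold.maximalAtlas (𝓡 n) ∞ M)
    (e : EuclideanSpace ℝ (Fin n)) :
    ContMDiffOn (𝓡 n) (𝓡 n).tangent ∞ (fun y ↦ (⟨φ.symm y, mfderiv (𝓡 n) (𝓡 n) φ.symm y e⟩ :
      TangentBundle (𝓡 n) M)) φ.target := by
  have h1 := (contMDiffOn_symm_of_mem_maximalAtlas hφ).contMDiffOn_tangentMapWithin (m := ∞)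
    (by simp) φ.open_target.uniqueMDiffOn
  have h2 : ContMDiff (𝓡 n) (𝓡 n).tangent ∞ (fun y : EuclideanSpace ℝ (Fin n) ↦
      (⟨y, e⟩ : TangentBundle (𝓡 n) (EuclideanSpace ℝ (Fin n)))) := fun y ↦
    contMDiffAt_vectorSpace_iff_contDiffAt.2 contDiffAt_const
  refine (h1.comp (h2.contMDiffOn (s := φ.target)) fun y hy ↦ hy).congr fun y hy ↦ ?_
  simp [tangentMapWithin, mfderivWithin_of_isOpen φ.open_target hy]

theorem contDiffOn_coordMatrix (hφ : φ ∈ IsManifold.maximalAtlas (𝓡 n) ∞ M) (i j : Fin n) :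
    ContDiffOn ℝ ∞ (fun y ↦ g.coordMatrix φ y i j) φ.target := by
  have h1 : ContMDiffOn (𝓡 n) ((𝓡 n).prod 𝓘(ℝ)) ∞ (fun y ↦
      Bundle.TotalSpace.mk' ℝ (E := Bundle.Trivial M ℝ) (φ.symm y) (g.coordMatrix φ y i j))
      φ.target :=
    ContMDiffOn.clm_bundle_apply₂ (F₁ := EuclideanSpace ℝ (Fin n))
      (F₂ := EuclideanSpace ℝ (Fin n))
      (g.contMDiff.comp_contMDiffOn (contMDiffOn_symm_of_mem_maximalAtlas hφ))
      (contMDiffOn_mfderiv_symm_apply hφ _) (contMDiffOn_mfderiv_symm_apply hφ _)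
  intro y hy
  have h2 := h1 y hy
  simp only [Bundle.contMDiffWithinAt_totalSpace] at h2
  exact h2.2.contDiffWithinAt

set_option synthInstance.maxHeartbeats 200000 in
theorem contDiffOn_coordForm (hφ : φ ∈ IsManifold.maximalAtlas (𝓡 n) ∞ M) :
    ContDiffOn ℝ ∞ (g.coordForm φ) φ.target :=
  ContDiffOn.sum fun i _ ↦ ContDiffOn.sum fun j _ ↦
    (g.contDiffOn_coordMatrix hφ i j).smul_fixed _

theorem differentiableAt_coordForm (hφ : φ ∈ IsManifold.maximalAtlas (𝓡 n) ∞ M)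
    {y : EuclideanSpace ℝ (Fin n)} (hy : y ∈ φ.target) :
    DifferentiableAt ℝ (g.coordForm φ) y :=
  ((g.contDiffOn_coordForm hφ).contDiffAt (φ.open_target.mem_nhds hy)).differentiableAt (by simp)

theorem coordMatrixDeriv_eq (hφ : φ ∈ IsManifold.maximalAtlas (𝓡 n) ∞ M)
    {y : EuclideanSpace ℝ (Fin n)} (hy : y ∈ φ.target) (i j l : Fin n) :
    g.coordMatrixDeriv φ y i j l = fderiv ℝ (g.coordForm φ) y (EuclideanSpace.single i 1)
      (EuclideanSpace.single j 1) (EuclideanSpace.single l 1) := by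
  have h1 : (fun z ↦ g.coordMatrix φ z j l) = fun z ↦
      g.coordForm φ z (EuclideanSpace.single j 1) (EuclideanSpace.single l 1) := by
    ext z
    rw [coordForm_single]
  have h2 := (((g.differentiableAt_coordForm hφ hy).hasFDerivAt.clm_apply
    (hasFDerivAt_const (EuclideanSpace.single j (1 : ℝ)) y)).clm_apply
    (hasFDerivAt_const (EuclideanSpace.single l (1 : ℝ)) y)).fderiv
  rw [coordMatrixDeriv, h1, h2]
  simp

variable {g} in
theorem IsNondegenerate.coordForm (hg : g.IsNondegenerate)
    (hφ : φ ∈ IsManifold.maximalAtlas (𝓡 n) ∞ M)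
    {y v : EuclideanSpace ℝ (Fin n)} (hy : y ∈ φ.target) (hv : ∀ w, g.coordForm φ y v w = 0) :
    v = 0 := by
  have hd := (mdifferentiable_of_mem_maximalAtlas hφ).symm
  have hy' : y ∈ φ.symm.source := hy
  refine hd.mfderiv_injective hy' ((hg _ _ fun w ↦ ?_).trans (map_zero _).symm)
  obtain ⟨w, rfl⟩ := hd.mfderiv_surjective hy' w
  exact (g.coordForm_apply φ y v w).symm.trans (hv w)

variable {g} in
theorem IsNondegenerate.isUnit_det_coordMatrix (hg : g.IsNondegenerate)
    (hφ : φ ∈ IsManifold.maximalAtlas (𝓡 n) ∞ M) {y : EuclideanSpace ℝ (Fin n)}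
    (hy : y ∈ φ.target) : IsUnit (g.coordMatrix φ y).det := by
  rw [isUnit_iff_ne_zero]
  intro h
  obtain ⟨v, hv0, hv⟩ := Matrix.exists_mulVec_eq_zero_iff.2 h
  apply hv0
  have := hg.coordForm hφ (v := WithLp.toLp 2 v) hy fun w ↦ by
    rw [g.coordForm_symm, EuclideanSpace.bilin_apply_eq_sum]
    refine Finset.sum_eq_zero fun i _ ↦ ?_
    have hvi : ∑ j, g.coordMatrix φ y i j * v j = 0 := congrFun hv i
    calc _ = w i * ∑ j, g.coordMatrix φ y i j * v j := by
          rw [Finset.mul_sum]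
          refine Finset.sum_congr rfl fun j _ ↦ ?_
          rw [coordForm_single, smul_eq_mul]
          ring
      _ = 0 := by rw [hvi, mul_zero]
  simpa using congrArg WithLp.ofLp this

/-- The Christoffel symbols of `g` in the chart `φ`, as a bilinear map on `ℝⁿ`. -/
def christoffelMap (φ : OpenPartialHomeomorph M (EuclideanSpace ℝ (Fin n)))
    (y : EuclideanSpace ℝ (Fin n)) :
    EuclideanSpace ℝ (Fin n) →L[ℝ] EuclideanSpace ℝ (Fin n) →L[ℝ] EuclideanSpace ℝ (Fin n) :=
  ∑ k, ∑ i, ∑ j, g.christoffel φ y k i j •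
    EuclideanSpace.basisBilin i j (EuclideanSpace.single k (1 : ℝ))

theorem christoffelMap_apply (φ : OpenPartialHomeomorph M (EuclideanSpace ℝ (Fin n)))
    (y u v : EuclideanSpace ℝ (Fin n)) (k : Fin n) :
    g.christoffelMap φ y u v k = ∑ i, ∑ j, g.christoffel φ y k i j * u i * v j := by
  have h : g.christoffelMap φ y u v =
      ∑ k, (∑ i, ∑ j, g.christoffel φ y k i j * u i * v j) • EuclideanSpace.single k (1 : ℝ) := by
    simp only [christoffelMap, sum_apply, smul_apply,
      EuclideanSpace.basisBilin_apply, Finset.sum_smul, mul_smul]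
  rw [h]
  exact congrArg (fun w : EuclideanSpace ℝ (Fin n) ↦ w k)
    (EuclideanSpace.sum_smul_single (WithLp.toLp 2 fun k ↦
      ∑ i, ∑ j, g.christoffel φ y k i j * u i * v j))

set_option synthInstance.maxHeartbeats 200000 in
variable {g} in
/-- The Christoffel symbols are smooth, as the inverse matrix is given by the adjugate. -/
theorem IsNondegenerate.contDiffOn_christoffelMap (hg : g.IsNondegenerate)
    (hφ : φ ∈ IsManifold.maximalAtlas (𝓡 n) ∞ M) :
    ContDiffOn ℝ ∞ (g.christoffelMap φ) φ.target := by
  have hder : ∀ i j l, ContDiffOn ℝ ∞ (fun y ↦ g.coordMatrixDeriv φ y i j l) φ.target := by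
    intro i j l
    exact ((g.contDiffOn_coordMatrix hφ j l).fderiv_of_isOpen φ.open_target
      (m := ∞) (by simp)).clm_apply contDiffOn_const
  have hinv : ∀ k l, ContDiffOn ℝ ∞ (fun y ↦ (g.coordMatrix φ y)⁻¹ k l) φ.target := by
    intro k l
    have hdet : ∀ (A : EuclideanSpace ℝ (Fin n) → Matrix (Fin n) (Fin n) ℝ),
        (∀ i j, ContDiffOn ℝ ∞ (fun y ↦ A y i j) φ.target) →
        ContDiffOn ℝ ∞ (fun y ↦ (A y).det) φ.target := by
      intro A hA
      simp only [Matrix.det_apply']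
      exact ContDiffOn.sum fun σ _ ↦ contDiffOn_const.mul (contDiffOn_prod fun i _ ↦ hA _ _)
    have hadj : ContDiffOn ℝ ∞ (fun y ↦ (g.coordMatrix φ y).adjugate k l) φ.target := by
      simp only [Matrix.adjugate_apply]
      refine hdet _ fun i j ↦ ?_
      by_cases hil : i = l
      · subst hil
        simpa using contDiffOn_const
      · simpa [Matrix.updateRow_ne hil] using g.contDiffOn_coordMatrix hφ i j
    have h1 : ContDiffOn ℝ ∞ (fun y ↦ (g.coordMatrix φ y).det⁻¹ *
        (g.coordMatrix φ y).adjugate k l) φ.target :=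
      ((hdet _ (g.contDiffOn_coordMatrix hφ)).inv
        fun y hy ↦ (hg.isUnit_det_coordMatrix hφ hy).ne_zero).mul hadj
    refine h1.congr fun y hy ↦ ?_
    rw [Matrix.inv_def, Ring.inverse_eq_inv']
    rfl
  have hΓ : ∀ k i j, ContDiffOn ℝ ∞ (fun y ↦ g.christoffel φ y k i j) φ.target := by
    intro k i j
    exact contDiffOn_const.mul (ContDiffOn.sum fun l _ ↦
      (hinv k l).mul (((hder i j l).add (hder j i l)).sub (hder l i j)))
  exact ContDiffOn.sum fun k _ ↦ ContDiffOn.sum fun i _ ↦ ContDiffOn.sum fun j _ ↦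
    (hΓ k i j).smul_fixed _

set_option synthInstance.maxHeartbeats 200000 in
variable {g} in
/-- Lowering the index of `Γ(u, u)` gives the Christoffel symbols of the first kind. -/
theorem IsNondegenerate.coordForm_christoffelMap (hg : g.IsNondegenerate)
    (hφ : φ ∈ IsManifold.maximalAtlas (𝓡 n) ∞ M) {y : EuclideanSpace ℝ (Fin n)}
    (hy : y ∈ φ.target) (u w : EuclideanSpace ℝ (Fin n)) :
    g.coordForm φ y (g.christoffelMap φ y u u) w =
      fderiv ℝ (g.coordForm φ) y u u w - (1 / 2 : ℝ) * fderiv ℝ (g.coordForm φ) y w u u := by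
  set T := fderiv ℝ (g.coordForm φ) y with hT
  set A := g.coordMatrix φ y with hA
  let c : Fin n → ℝ := fun l ↦ T u u (EuclideanSpace.single l 1) -
    (1 / 2 : ℝ) * T (EuclideanSpace.single l 1) u u
  have hc : ∀ l, c l = ∑ i, ∑ j, (1 / 2 : ℝ) * (u i * u j * (g.coordMatrixDeriv φ y i j l +
      g.coordMatrixDeriv φ y j i l - g.coordMatrixDeriv φ y l i j)) := by
    intro l
    have h1 : T u u (EuclideanSpace.single l 1) =
        ∑ i, ∑ j, u i * u j * g.coordMatrixDeriv φ y i j l := by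
      rw [EuclideanSpace.bilin_apply_eq_sum T u u]
      simp only [sum_apply, smul_apply, smul_eq_mul, g.coordMatrixDeriv_eq hφ hy, hT]
    have h2 : T u u (EuclideanSpace.single l 1) =
        ∑ i, ∑ j, u i * u j * g.coordMatrixDeriv φ y j i l := by
      rw [h1, Finset.sum_comm]
      simp only [mul_comm (u _) (u _)]
    have h3 : T (EuclideanSpace.single l 1) u u =
        ∑ i, ∑ j, u i * u j * g.coordMatrixDeriv φ y l i j := by
      rw [EuclideanSpace.bilin_apply_eq_sum (T (EuclideanSpace.single l 1)) u u]
      simp only [smul_eq_mul, g.coordMatrixDeriv_eq hφ hy, hT]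
    simp only [← Finset.mul_sum, mul_add, mul_sub, Finset.sum_add_distrib,
      Finset.sum_sub_distrib, ← h1, ← h2, ← h3, c]
    ring
  have hΓ : ∀ k, g.christoffelMap φ y u u k = (A⁻¹.mulVec c) k := by
    intro k
    rw [christoffelMap_apply]
    simp only [Matrix.mulVec, dotProduct, hc, christoffel, Finset.mul_sum, Finset.sum_mul]
    rw [Finset.sum_comm_cycle]
    refine Finset.sum_congr rfl fun l _ ↦ Finset.sum_congr rfl fun i _ ↦
      Finset.sum_congr rfl fun j _ ↦ ?_
    ring
  have hm : ∀ m, g.coordForm φ y (g.christoffelMap φ y u u) (EuclideanSpace.single m 1) = c m := by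
    intro m
    have h1 : A.mulVec (A⁻¹.mulVec c) = c := by
      rw [Matrix.mulVec_mulVec, Matrix.mul_nonsing_inv _ (hg.isUnit_det_coordMatrix hφ hy),
        Matrix.one_mulVec]
    rw [← congrFun h1 m, ← EuclideanSpace.sum_smul_single (g.christoffelMap φ y u u),
      g.coordForm_symm, map_sum]
    refine Finset.sum_congr rfl fun k _ ↦ ?_
    rw [map_smul, coordForm_single, hΓ, smul_eq_mul, mul_comm]
  rw [← EuclideanSpace.sum_smul_single w]
  simp only [map_sum, map_smul, hm, sum_apply, smul_apply, Finset.mul_sum, c]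
  rw [← Finset.sum_sub_distrib]
  refine Finset.sum_congr rfl fun k _ ↦ ?_
  simp only [smul_eq_mul]
  ring

set_option synthInstance.maxHeartbeats 200000 in
variable {g} in
/-- The geodesic equation in a chart is the Euler-Lagrange equation of the energy. -/
theorem IsNondegenerate.geodesicEquation_iff (hg : g.IsNondegenerate)
    (hφ : φ ∈ IsManifold.maximalAtlas (𝓡 n) ∞ M) {y : EuclideanSpace ℝ (Fin n)}
    (hy : y ∈ φ.target) (u a : EuclideanSpace ℝ (Fin n)) :
    a + g.christoffelMap φ y u u = 0 ↔ ∀ w, eulerLagrange (g.coordForm φ) y u a w = 0 := by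
  have hlin : ∀ w, eulerLagrange (g.coordForm φ) y u a w =
      g.coordForm φ y (a + g.christoffelMap φ y u u) w := by
    intro w
    rw [map_add, add_apply, hg.coordForm_christoffelMap hφ hy, eulerLagrange, add_sub_assoc]
  constructor
  · intro h w
    rw [hlin, h]
    simp
  · intro h
    exact hg.coordForm hφ hy fun w ↦ by rw [← hlin, h]

end SymmetricTensorField
end SemiRiemannian

/-! ### Geodesics: change of charts, uniqueness and the exponential map -/

theorem EuclideanSpace.deriv_apply {n : ℕ} {x : ℝ → EuclideanSpace ℝ (Fin n)} {t : ℝ}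
    (hx : DifferentiableAt ℝ x t) (k : Fin n) : deriv (fun s ↦ x s k) t = deriv x t k :=
  ((EuclideanSpace.proj k : EuclideanSpace ℝ (Fin n) →L[ℝ] ℝ).hasFDerivAt.comp_hasDerivAt t
    hx.hasDerivAt).deriv

theorem ContDiffAt.differentiableAt_deriv {E : Type*} [NormedAddCommGroup E] [NormedSpace ℝ E]
    {x : ℝ → E} {t : ℝ} (hx : ContDiffAt ℝ 2 x t) : DifferentiableAt ℝ (deriv x) t :=
  ((hx.fderiv_right (m := 1) (by norm_num [one_add_one_eq_two])).differentiableAt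
    (by simp)).clm_apply (differentiableAt_const 1)

theorem ContDiffAt.two_of_infty {E F : Type*} [NormedAddCommGroup E] [NormedSpace ℝ E]
    [NormedAddCommGroup F] [NormedSpace ℝ F] {f : E → F} {x : E} (hf : ContDiffAt ℝ ∞ f x) :
    ContDiffAt ℝ 2 f x := by
  exact_mod_cast contDiffAt_infty.1 hf 2

section Velocity

variable {n : ℕ} {M : Type*} [TopologicalSpace M]
  [ChartedSpace (EuclideanSpace ℝ (Fin n)) M]
  {φ : OpenPartialHomeomorph M (EuclideanSpace ℝ (Fin n))}

theorem contDiffAt_chart_comp (hφ : φ ∈ IsManifold.maximalAtlas (𝓡 n) ∞ M) {γ : ℝ → M} {t : ℝ}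
    (hγ : ContMDiffAt 𝓘(ℝ, ℝ) (𝓡 n) ∞ γ t) (ht : γ t ∈ φ.source) :
    ContDiffAt ℝ ∞ (fun s ↦ φ (γ s)) t :=
  contMDiffAt_iff_contDiffAt.1 (ContMDiffAt.comp t
    ((contMDiffOn_of_mem_maximalAtlas hφ).contMDiffAt (φ.open_source.mem_nhds ht)) hγ)

theorem contDiffAt_chart_comp_symm {φ' : OpenPartialHomeomorph M (EuclideanSpace ℝ (Fin n))}
    (hφ : φ ∈ IsManifold.maximalAtlas (𝓡 n) ∞ M) (hφ' : φ' ∈ IsManifold.maximalAtlas (𝓡 n) ∞ M)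
    {y : EuclideanSpace ℝ (Fin n)} (hy : y ∈ φ.target) (hy' : φ.symm y ∈ φ'.source) :
    ContDiffAt ℝ ∞ (fun z ↦ φ' (φ.symm z)) y :=
  contMDiffAt_iff_contDiffAt.1 (ContMDiffAt.comp y
    ((contMDiffOn_of_mem_maximalAtlas hφ').contMDiffAt (φ'.open_source.mem_nhds hy'))
    ((contMDiffOn_symm_of_mem_maximalAtlas hφ).contMDiffAt (φ.open_target.mem_nhds hy)))

/-- The velocity of a curve, in terms of the velocity of its coordinate expression. -/
theorem mfderiv_eq_iff_deriv_chart (hφ : φ ∈ IsManifold.maximalAtlas (𝓡 n) ∞ M) {γ : ℝ → M}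
    {t : ℝ} {q : M} (hγ : MDifferentiableAt 𝓘(ℝ, ℝ) (𝓡 n) γ t) (hq : γ t = q)
    (hqφ : q ∈ φ.source) (v : TangentSpace (𝓡 n) q) :
    (mfderiv 𝓘(ℝ, ℝ) (𝓡 n) γ t (1 : ℝ) : EuclideanSpace ℝ (Fin n)) = v ↔
      deriv (fun s ↦ φ (γ s)) t = mfderiv (𝓡 n) (𝓡 n) φ q v := by
  subst hq
  have hd := mdifferentiable_of_mem_maximalAtlas hφ
  have h1 : mfderiv 𝓘(ℝ, ℝ) (𝓡 n) (fun s ↦ φ (γ s)) t =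
      (mfderiv (𝓡 n) (𝓡 n) φ (γ t)).comp (mfderiv 𝓘(ℝ, ℝ) (𝓡 n) γ t) :=
    mfderiv_comp t (hd.mdifferentiableAt hqφ) hγ
  have h2 : deriv (fun s ↦ φ (γ s)) t =
      mfderiv (𝓡 n) (𝓡 n) φ (γ t) (mfderiv 𝓘(ℝ, ℝ) (𝓡 n) γ t (1 : ℝ)) := by
    rw [mfderiv_eq_fderiv] at h1
    exact congrArg (fun L : ℝ →L[ℝ] EuclideanSpace ℝ (Fin n) ↦ L 1) h1
  rw [h2]
  exact (hd.mfderiv_injective hqφ).eq_iff.symm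

end Velocity

namespace SemiRiemannian

variable {n : ℕ} {M : Type*} [TopologicalSpace M]
  [ChartedSpace (EuclideanSpace ℝ (Fin n)) M] [IsManifold (𝓡 n) ∞ M]

namespace SymmetricTensorField

variable {g : SymmetricTensorField n M}
  {φ φ' : OpenPartialHomeomorph M (EuclideanSpace ℝ (Fin n))}

/-- The coordinate form of the geodesic equation, as an equation between vectors. -/
theorem geodesicEquation_coord_iff {x : ℝ → EuclideanSpace ℝ (Fin n)} {t : ℝ}
    (hx : ContDiffAt ℝ 2 x t) :
    (∀ k : Fin n, deriv (deriv fun s ↦ x s k) t + ∑ i, ∑ j, g.christoffel φ (x t) k i j *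
        deriv (fun s ↦ x s i) t * deriv (fun s ↦ x s j) t = 0) ↔
      deriv (deriv x) t + g.christoffelMap φ (x t) (deriv x t) (deriv x t) = 0 := by
  have h1 : ∀ k, deriv (fun s ↦ x s k) t = deriv x t k :=
    EuclideanSpace.deriv_apply (hx.differentiableAt (by simp))
  have h2 : ∀ k, deriv (deriv fun s ↦ x s k) t = deriv (deriv x) t k := by
    intro k
    rw [← EuclideanSpace.deriv_apply hx.differentiableAt_deriv]
    refine Filter.EventuallyEq.deriv_eq ?_
    filter_upwards [hx.eventually (by simp)] with s hs
    exact EuclideanSpace.deriv_apply (hs.differentiableAt (by simp)) k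
  simp only [h1, h2, ← christoffelMap_apply]
  constructor
  · intro h
    ext k
    exact h k
  · intro h k
    exact congrArg (fun w : EuclideanSpace ℝ (Fin n) ↦ w k) h

/-- The coordinate expressions of the metric in two charts are related by the derivative of the
transition map. -/
theorem coordForm_change (g : SymmetricTensorField n M)
    (hφ : φ ∈ IsManifold.maximalAtlas (𝓡 n) ∞ M)
    (hφ' : φ' ∈ IsManifold.maximalAtlas (𝓡 n) ∞ M) {z : EuclideanSpace ℝ (Fin n)}
    (hz : z ∈ φ.target) (hz' : φ.symm z ∈ φ'.source) (v w : EuclideanSpace ℝ (Fin n)) :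
    g.coordForm φ z v w = g.coordForm φ' (φ' (φ.symm z))
      (fderiv ℝ (fun z ↦ φ' (φ.symm z)) z v) (fderiv ℝ (fun z ↦ φ' (φ.symm z)) z w) := by
  have hform : ∀ {p q : M} (_ : p = q) (a b : EuclideanSpace ℝ (Fin n)),
      g.form p a b = g.form q a b := by
    rintro p _ rfl a b
    rfl
  have hev : φ.symm =ᶠ[𝓝 z] fun z ↦ φ'.symm (φ' (φ.symm z)) := by
    filter_upwards [(φ.continuousAt_symm hz).eventually (φ'.open_source.mem_nhds hz')] with y hy
    exact (φ'.left_inv hy).symm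
  have hψ : MDifferentiableAt (𝓡 n) (𝓡 n) (fun z ↦ φ' (φ.symm z)) z :=
    ((contDiffAt_chart_comp_symm hφ hφ' hz hz').differentiableAt (by simp)).mdifferentiableAt
  have hd : ∀ v : EuclideanSpace ℝ (Fin n), (mfderiv (𝓡 n) (𝓡 n) φ.symm z v :
      EuclideanSpace ℝ (Fin n)) = mfderiv (𝓡 n) (𝓡 n) φ'.symm (φ' (φ.symm z))
        (fderiv ℝ (fun z ↦ φ' (φ.symm z)) z v) := by
    intro v
    have h1 := mfderiv_comp z
      ((mdifferentiable_of_mem_maximalAtlas hφ').mdifferentiableAt_symm (φ'.map_source hz')) hψ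
    rw [mfderiv_eq_fderiv] at h1
    have h2 := hev.mfderiv_eq (I := 𝓡 n) (I' := 𝓡 n)
    exact (congrArg (fun L : EuclideanSpace ℝ (Fin n) →L[ℝ] EuclideanSpace ℝ (Fin n) ↦ L v) h2).trans
      (congrArg (fun L : EuclideanSpace ℝ (Fin n) →L[ℝ] EuclideanSpace ℝ (Fin n) ↦ L v) h1)
  rw [coordForm_apply, coordForm_apply]
  refine (hform (φ'.left_inv hz').symm _ _).trans ?_
  exact congrArg₂ (fun a b : EuclideanSpace ℝ (Fin n) ↦
    g.form (φ'.symm (φ' (φ.symm z))) a b) (hd v) (hd w)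

/-- The geodesic equation does not depend on the chart. -/
theorem IsNondegenerate.geodesicEquation_change (hg : g.IsNondegenerate)
    (hφ : φ ∈ IsManifold.maximalAtlas (𝓡 n) ∞ M)
    (hφ' : φ' ∈ IsManifold.maximalAtlas (𝓡 n) ∞ M) {γ : ℝ → M} {t : ℝ}
    (hγ : ContMDiffAt 𝓘(ℝ, ℝ) (𝓡 n) ∞ γ t) (ht : γ t ∈ φ.source) (ht' : γ t ∈ φ'.source)
    (h : deriv (deriv fun s ↦ φ' (γ s)) t + g.christoffelMap φ' (φ' (γ t))
      (deriv (fun s ↦ φ' (γ s)) t) (deriv (fun s ↦ φ' (γ s)) t) = 0) :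
    deriv (deriv fun s ↦ φ (γ s)) t + g.christoffelMap φ (φ (γ t))
      (deriv (fun s ↦ φ (γ s)) t) (deriv (fun s ↦ φ (γ s)) t) = 0 := by
  set x : ℝ → EuclideanSpace ℝ (Fin n) := fun s ↦ φ (γ s) with hx
  let ψ : EuclideanSpace ℝ (Fin n) → EuclideanSpace ℝ (Fin n) := fun z ↦ φ' (φ.symm z)
  have hxt : x t ∈ φ.target := φ.map_source ht
  have hinv : φ.symm (x t) = γ t := φ.left_inv ht
  have hxt' : φ.symm (x t) ∈ φ'.source := by rwa [hinv]
  have hψx : ψ (x t) = φ' (γ t) := congrArg φ' hinv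
  have hxs : ContDiffAt ℝ 2 x t := (contDiffAt_chart_comp hφ hγ ht).two_of_infty
  have hψs : ContDiffAt ℝ 2 ψ (x t) :=
    (contDiffAt_chart_comp_symm hφ hφ' hxt hxt').two_of_infty
  have hev : (fun s ↦ φ' (γ s)) =ᶠ[𝓝 t] fun s ↦ ψ (x s) := by
    filter_upwards [hγ.continuousAt.eventually (φ.open_source.mem_nhds ht)] with s hs
    exact congrArg φ' (φ.left_inv hs).symm
  rw [hev.deriv.deriv_eq, hev.deriv_eq, (deriv_comp_eventuallyEq hxs hψs).self_of_nhds,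
    deriv_deriv_comp hxs hψs, hg.geodesicEquation_iff hφ' (φ'.map_source ht')] at h
  rw [hg.geodesicEquation_iff hφ hxt]
  intro w
  rw [eulerLagrange_pullback hψs (g.differentiableAt_coordForm hφ hxt)
    (by rw [hψx]; exact g.differentiableAt_coordForm hφ' (φ'.map_source ht'))
    (g.coordForm_symm φ' _), hψx]
  · exact h _
  · filter_upwards [φ.open_target.mem_nhds hxt,
      (φ.continuousAt_symm hxt).eventually (φ'.open_source.mem_nhds hxt')] with z hz hz' v w
    exact g.coordForm_change hφ hφ' hz hz' v w

theorem IsGeodesicOn.contMDiffAt {γ : ℝ → M} {J : Set ℝ} (h : g.IsGeodesicOn γ J) (hJ : IsOpen J)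
    {t : ℝ} (ht : t ∈ J) : ContMDiffAt 𝓘(ℝ, ℝ) (𝓡 n) ∞ γ t :=
  h.1.contMDiffAt (hJ.mem_nhds ht)

theorem IsGeodesicOn.equation {γ : ℝ → M} {J : Set ℝ} (h : g.IsGeodesicOn γ J) (hJ : IsOpen J)
    {t : ℝ} (ht : t ∈ J) (hφ : φ ∈ IsManifold.maximalAtlas (𝓡 n) ∞ M) (hγ : γ t ∈ φ.source) :
    deriv (deriv fun s ↦ φ (γ s)) t + g.christoffelMap φ (φ (γ t))
      (deriv (fun s ↦ φ (γ s)) t) (deriv (fun s ↦ φ (γ s)) t) = 0 :=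
  (geodesicEquation_coord_iff (contDiffAt_chart_comp hφ (h.contMDiffAt hJ ht) hγ).two_of_infty).1
    (h.2 t ht φ hφ hγ)

/-- To be a geodesic, it suffices to satisfy the geodesic equation in one chart around each
point. -/
theorem IsNondegenerate.isGeodesicOn_of_exists_chart (hg : g.IsNondegenerate) {γ : ℝ → M}
    {J : Set ℝ} (hJ : IsOpen J) (hγ : ContMDiffOn 𝓘(ℝ, ℝ) (𝓡 n) ∞ γ J)
    (h : ∀ t ∈ J, ∃ φ ∈ IsManifold.maximalAtlas (𝓡 n) ∞ M, γ t ∈ φ.source ∧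
      deriv (deriv fun s ↦ φ (γ s)) t + g.christoffelMap φ (φ (γ t))
        (deriv (fun s ↦ φ (γ s)) t) (deriv (fun s ↦ φ (γ s)) t) = 0) :
    g.IsGeodesicOn γ J := by
  refine ⟨hγ, fun t ht φ hφ hφt ↦ ?_⟩
  have hγt := hγ.contMDiffAt (hJ.mem_nhds ht)
  obtain ⟨φ', hφ', hφ't, heq⟩ := h t ht
  exact (geodesicEquation_coord_iff (contDiffAt_chart_comp hφ hγt hφt).two_of_infty).2
    (hg.geodesicEquation_change hφ hφ' hγt hφt hφ't heq)

/-- Position and velocity of a geodesic in a chart form an integral curve of the geodesic vector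
field. -/
theorem IsGeodesicOn.hasDerivAt_chart {γ : ℝ → M} {J : Set ℝ} (h : g.IsGeodesicOn γ J)
    (hJ : IsOpen J) {t : ℝ} (ht : t ∈ J) (hφ : φ ∈ IsManifold.maximalAtlas (𝓡 n) ∞ M)
    (hγ : γ t ∈ φ.source) :
    HasDerivAt (fun s ↦ (φ (γ s), deriv (fun r ↦ φ (γ r)) s))
      (geodesicField (g.christoffelMap φ) (φ (γ t), deriv (fun r ↦ φ (γ r)) t)) t := by
  have hx : ContDiffAt ℝ 2 (fun s ↦ φ (γ s)) t :=
    (contDiffAt_chart_comp hφ (h.contMDiffAt hJ ht) hγ).two_of_infty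
  refine ((hx.differentiableAt (by simp)).hasDerivAt.prodMk
    hx.differentiableAt_deriv.hasDerivAt).congr_deriv ?_
  rw [geodesicField, ← eq_neg_of_add_eq_zero_left (h.equation hJ ht hφ hγ)]

/-- Local uniqueness of geodesics, from uniqueness for the first order system in a chart. -/
theorem IsNondegenerate.eventuallyEq_of_isGeodesicOn (hg : g.IsNondegenerate) {γ₁ γ₂ : ℝ → M}
    {J : Set ℝ} (hJ : IsOpen J) (h₁ : g.IsGeodesicOn γ₁ J) (h₂ : g.IsGeodesicOn γ₂ J) {t : ℝ}
    (ht : t ∈ J) (hφ : φ ∈ IsManifold.maximalAtlas (𝓡 n) ∞ M) (hφt : γ₁ t ∈ φ.source)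
    (heq : γ₁ t = γ₂ t)
    (hd : deriv (fun s ↦ φ (γ₁ s)) t = deriv (fun s ↦ φ (γ₂ s)) t) : γ₁ =ᶠ[𝓝 t] γ₂ := by
  have hX : ContDiffAt ℝ 1 (geodesicField (g.christoffelMap φ))
      (φ (γ₁ t), deriv (fun s ↦ φ (γ₁ s)) t) :=
    ContDiffAt.geodesicField (((hg.contDiffOn_christoffelMap hφ).contDiffAt
      (φ.open_target.mem_nhds (φ.map_source hφt))).of_le (by exact_mod_cast le_top))
  obtain ⟨K, s, hs, hlip⟩ := hX.exists_lipschitzOnWith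
  have hz : ∀ {γ : ℝ → M}, g.IsGeodesicOn γ J → γ t ∈ φ.source →
      (φ (γ t), deriv (fun s ↦ φ (γ s)) t) = (φ (γ₁ t), deriv (fun s ↦ φ (γ₁ s)) t) →
      ∀ᶠ r in 𝓝 t, γ r ∈ φ.source ∧ HasDerivAt (fun s ↦ (φ (γ s), deriv (fun r ↦ φ (γ r)) s))
        (geodesicField (g.christoffelMap φ) (φ (γ r), deriv (fun s ↦ φ (γ s)) r)) r ∧
        (φ (γ r), deriv (fun s ↦ φ (γ s)) r) ∈ s := by
    intro γ h hγt hγ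
    have hc := (h.hasDerivAt_chart hJ ht hφ hγt).continuousAt
    have hs' : s ∈ 𝓝 (φ (γ t), deriv (fun s ↦ φ (γ s)) t) := by rwa [hγ]
    filter_upwards [hJ.mem_nhds ht, (h.contMDiffAt hJ ht).continuousAt.eventually
      (φ.open_source.mem_nhds hγt), hc.eventually hs'] with r hr hrφ hrs
    exact ⟨hrφ, h.hasDerivAt_chart hJ hr hφ hrφ, hrs⟩
  have e₁ := hz h₁ hφt rfl
  have e₂ := hz h₂ (heq ▸ hφt) (by rw [hd, heq])
  have := ODE_solution_unique_of_eventually (v := fun _ ↦ geodesicField (g.christoffelMap φ))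
    (Filter.Eventually.of_forall fun _ ↦ hlip) (e₁.mono fun _ h ↦ h.2) (e₂.mono fun _ h ↦ h.2)
    (by simp only [heq, hd])
  filter_upwards [this, e₁, e₂] with r hr hr₁ hr₂
  exact φ.injOn hr₁.1 hr₂.1 (congrArg Prod.fst hr)

/-- Geodesics on a Hausdorff manifold are determined by their initial position and velocity. -/
theorem IsNondegenerate.eqOn_of_isGeodesicOn [T2Space M] (hg : g.IsNondegenerate)
    {γ₁ γ₂ : ℝ → M} {a b : ℝ} (h₁ : g.IsGeodesicOn γ₁ (Ioo a b))
    (h₂ : g.IsGeodesicOn γ₂ (Ioo a b)) {t₀ : ℝ}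
    (ht₀ : t₀ ∈ Ioo a b) (hφ : φ ∈ IsManifold.maximalAtlas (𝓡 n) ∞ M)
    (hφt : γ₁ t₀ ∈ φ.source) (heq : γ₁ t₀ = γ₂ t₀)
    (hd : deriv (fun s ↦ φ (γ₁ s)) t₀ = deriv (fun s ↦ φ (γ₂ s)) t₀) :
    EqOn γ₁ γ₂ (Ioo a b) := by
  -- the set near which the curves agree is open; it is relatively closed, as at a limit point
  -- position and velocity agree by continuity
  let S : Set ℝ := {t | γ₁ =ᶠ[𝓝 t] γ₂}
  have hS : IsOpen S := isOpen_setOfPred_eventually_nhds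
  suffices Ioo a b ⊆ S from fun t ht ↦ (this ht).self_of_nhds
  refine isPreconnected_Ioo.subset_of_closure_inter_subset hS
    ⟨t₀, ht₀, hg.eventuallyEq_of_isGeodesicOn isOpen_Ioo h₁ h₂ ht₀ hφ hφt heq hd⟩ ?_
  rintro t ⟨htS, ht⟩
  have hfreq : ∃ᶠ s in 𝓝 t, s ∈ S := mem_closure_iff_frequently.1 htS
  have hc₁ := h₁.contMDiffAt isOpen_Ioo ht
  have hc₂ := h₂.contMDiffAt isOpen_Ioo ht
  have heq' : γ₁ t = γ₂ t := by
    by_contra hne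
    obtain ⟨s, hs, hs'⟩ := (hfreq.and_eventually
      ((hc₁.continuousAt.ne_iff_eventually_ne hc₂.continuousAt).1 hne)).exists
    exact hs' hs.self_of_nhds
  have hφ' : chartAt (EuclideanSpace ℝ (Fin n)) (γ₁ t) ∈ IsManifold.maximalAtlas (𝓡 n) ∞ M :=
    IsManifold.chart_mem_maximalAtlas _
  set φ' := chartAt (EuclideanSpace ℝ (Fin n)) (γ₁ t)
  have hφ't : γ₁ t ∈ φ'.source := mem_chart_source _ _
  refine hg.eventuallyEq_of_isGeodesicOn isOpen_Ioo h₁ h₂ ht hφ' hφ't heq' ?_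
  have hv₁ := (h₁.hasDerivAt_chart isOpen_Ioo ht hφ' hφ't).continuousAt.snd
  have hv₂ := (h₂.hasDerivAt_chart isOpen_Ioo ht hφ' (heq' ▸ hφ't)).continuousAt.snd
  by_contra hne
  obtain ⟨s, hs, hs'⟩ := (hfreq.and_eventually
    ((hv₁.ne_iff_eventually_ne hv₂).1 hne)).exists
  refine hs' (Filter.EventuallyEq.deriv_eq ?_)
  filter_upwards [hs] with r hr
  rw [hr]

/-- The initial condition of `IsGeodesicFrom`, read in an arbitrary chart. -/
theorem isGeodesicFrom_iff (hφ : φ ∈ IsManifold.maximalAtlas (𝓡 n) ∞ M) {q : M}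
    (hq : q ∈ φ.source) {v : TangentSpace (𝓡 n) q} {γ : ℝ → M} :
    g.IsGeodesicFrom q v γ ↔ (∃ a b : ℝ, a < 0 ∧ 1 < b ∧ g.IsGeodesicOn γ (Ioo a b)) ∧
      γ 0 = q ∧ deriv (fun s ↦ φ (γ s)) 0 = mfderiv (𝓡 n) (𝓡 n) φ q v := by
  refine and_congr_right fun ⟨a, b, ha, hb, h⟩ ↦ and_congr_right fun h0 ↦ ?_
  exact mfderiv_eq_iff_deriv_chart hφ ((h.contMDiffAt isOpen_Ioo
    ⟨ha, by linarith⟩).mdifferentiableAt (by simp)) h0 hq v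

theorem IsGeodesicOn.mono {γ : ℝ → M} {J J' : Set ℝ} (h : g.IsGeodesicOn γ J) (hJ : J' ⊆ J) :
    g.IsGeodesicOn γ J' :=
  ⟨h.1.mono hJ, fun t ht ↦ h.2 t (hJ ht)⟩

/-- `expMap` does not depend on the choice of the geodesic in its definition. -/
theorem IsNondegenerate.expMap_eq [T2Space M] (hg : g.IsNondegenerate) {q : M}
    {v : TangentSpace (𝓡 n) q} {γ : ℝ → M} (hγ : g.IsGeodesicFrom q v γ) :
    g.expMap q v = γ 1 := by
  have hex : ∃ γ, g.IsGeodesicFrom q v γ := ⟨γ, hγ⟩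
  rw [expMap, dif_pos hex]
  have hφ : chartAt (EuclideanSpace ℝ (Fin n)) q ∈ IsManifold.maximalAtlas (𝓡 n) ∞ M :=
    IsManifold.chart_mem_maximalAtlas _
  have hq := mem_chart_source (EuclideanSpace ℝ (Fin n)) q
  obtain ⟨⟨a, b, ha, hb, h⟩, h0, hd⟩ := (isGeodesicFrom_iff hφ hq).1 hex.choose_spec
  obtain ⟨⟨a', b', ha', hb', h'⟩, h0', hd'⟩ := (isGeodesicFrom_iff hφ hq).1 hγ
  have hsub : Ioo (max a a') (min b b') ⊆ Ioo a b :=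
    Ioo_subset_Ioo (le_max_left _ _) (min_le_left _ _)
  have hsub' : Ioo (max a a') (min b b') ⊆ Ioo a' b' :=
    Ioo_subset_Ioo (le_max_right _ _) (min_le_right _ _)
  exact hg.eqOn_of_isGeodesicOn (h.mono hsub) (h'.mono hsub') (t₀ := 0)
    ⟨max_lt ha ha', lt_min (by linarith) (by linarith)⟩ hφ (by rwa [h0]) (h0.trans h0'.symm)
    (hd.trans hd'.symm) ⟨max_lt (by linarith) (by linarith), lt_min hb hb'⟩

/-- The initial part of a geodesic, reparametrized to the unit interval. -/
theorem IsNondegenerate.isGeodesicFrom_smul (hg : g.IsNondegenerate) {q : M}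
    {v : TangentSpace (𝓡 n) q} {γ : ℝ → M} (hγ : g.IsGeodesicFrom q v γ) {c : ℝ}
    (hc : c ∈ Icc (0 : ℝ) 1) : g.IsGeodesicFrom q (c • v) fun s ↦ γ (c * s) := by
  have hφ : chartAt (EuclideanSpace ℝ (Fin n)) q ∈ IsManifold.maximalAtlas (𝓡 n) ∞ M :=
    IsManifold.chart_mem_maximalAtlas _
  have hq := mem_chart_source (EuclideanSpace ℝ (Fin n)) q
  obtain ⟨⟨a, b, ha, hb, h⟩, h0, hd⟩ := (isGeodesicFrom_iff hφ hq).1 hγ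
  have hmaps : ∀ s ∈ Ioo a b, c * s ∈ Ioo a b := fun s hs ↦
    (convex_Ioo a b).smul_mem_of_zero_mem ⟨ha, by linarith⟩ hs hc
  have hderiv : ∀ (φ : OpenPartialHomeomorph M (EuclideanSpace ℝ (Fin n))) (s : ℝ),
      deriv (fun s ↦ φ (γ (c * s))) s = c • deriv (fun s ↦ φ (γ s)) (c * s) :=
    fun φ s ↦ deriv_comp_mul_left c (fun s ↦ φ (γ s)) s
  refine (isGeodesicFrom_iff hφ hq).2 ⟨⟨a, b, ha, hb, ?_⟩, by simpa using h0, ?_⟩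
  · refine hg.isGeodesicOn_of_exists_chart isOpen_Ioo (h.1.comp
      (contMDiff_iff_contDiff.2 (contDiff_const.mul contDiff_id)).contMDiffOn hmaps) ?_
    intro s hs
    have hφ' : chartAt (EuclideanSpace ℝ (Fin n)) (γ (c * s)) ∈
      IsManifold.maximalAtlas (𝓡 n) ∞ M := IsManifold.chart_mem_maximalAtlas _
    refine ⟨_, hφ', mem_chart_source _ _, ?_⟩
    set φ' := chartAt (EuclideanSpace ℝ (Fin n)) (γ (c * s))
    have heq := h.equation isOpen_Ioo (hmaps s hs) hφ' (mem_chart_source _ _)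
    have h2 : deriv (deriv fun s ↦ φ' (γ (c * s))) s =
        c • c • deriv (deriv fun s ↦ φ' (γ s)) (c * s) := by
      rw [funext (hderiv φ'), deriv_fun_const_smul_field,
        deriv_comp_mul_left c (deriv fun s ↦ φ' (γ s)) s]
    rw [h2, hderiv, map_smul, map_smul, smul_apply, ← smul_add, ← smul_add, heq]
    simp
  · rw [hderiv, mul_zero, hd]
    exact (map_smul (mfderiv (𝓡 n) (𝓡 n) _ q) c v).symm

end SymmetricTensorField
end SemiRiemannian

/-! ### Existence of small normal convex neighbourhoods -/

/-- A map that is smooth near `p` agrees near `p` with a globally smooth map. -/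
theorem ContDiffOn.exists_contDiff_eventuallyEq {E F : Type*} [NormedAddCommGroup E]
    [NormedSpace ℝ E] [HasContDiffBump E] [NormedAddCommGroup F] [NormedSpace ℝ F] {h : E → F}
    [FiniteDimensional ℝ E] {Ω : Set E} (hh : ContDiffOn ℝ ∞ h Ω) (hΩ : IsOpen Ω) {p : E}
    (hp : p ∈ Ω) : ∃ h' : E → F, ContDiff ℝ ∞ h' ∧ h' =ᶠ[𝓝 p] h := by
  obtain ⟨r, hr, hrΩ⟩ := Metric.nhds_basis_closedBall.mem_iff.1 (hΩ.mem_nhds hp)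
  let f : ContDiffBump p := ⟨r / 2, r, by positivity, by linarith⟩
  refine ⟨fun x ↦ f x • h x, contDiff_iff_contDiffAt.2 fun x ↦ ?_, ?_⟩
  · by_cases hx : x ∈ Ω
    · exact f.contDiff.contDiffAt.smul (hh.contDiffAt (hΩ.mem_nhds hx))
    · have hx' : x ∉ tsupport f := fun h ↦ hx (hrΩ (by rwa [f.tsupport_eq] at h))
      refine (contDiffAt_const (c := (0 : F))).congr_of_eventuallyEq ?_
      filter_upwards [notMem_tsupport_iff_eventuallyEq.1 hx'] with y hy
      simp [hy]
  · filter_upwards [f.eventuallyEq_one] with x hx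
    simp [hx]

/-- Integral curves of a smooth vector field are smooth. -/
theorem contDiffOn_of_hasDerivAt_comp {F : Type*} [NormedAddCommGroup F] [NormedSpace ℝ F]
    {X : F → F} {s : Set F} (hX : ContDiffOn ℝ ∞ X s) {z : ℝ → F} {J : Set ℝ} (hJ : IsOpen J)
    (hzs : MapsTo z J s) (hz : ∀ t ∈ J, HasDerivAt z (X (z t)) t) : ContDiffOn ℝ ∞ z J := by
  refine contDiffOn_infty.2 fun m ↦ ?_
  induction m with
  | zero => exact contDiffOn_zero.2 fun t ht ↦ (hz t ht).continuousAt.continuousWithinAt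
  | succ m ih =>
    have h1 := (contDiffOn_succ_iff_deriv_of_isOpen (n := (m : WithTop ℕ∞)) hJ).2
      ⟨fun t ht ↦ (hz t ht).differentiableAt.differentiableWithinAt, by simp,
        ((contDiffOn_infty.1 hX m).comp ih hzs).congr fun t ht ↦ (hz t ht).deriv⟩
    exact_mod_cast h1

namespace SemiRiemannian

variable {n : ℕ} {M : Type*} [TopologicalSpace M]
  [ChartedSpace (EuclideanSpace ℝ (Fin n)) M] [IsManifold (𝓡 n) ∞ M]

namespace SymmetricTensorField

variable {g : SymmetricTensorField n M}
  {φ : OpenPartialHomeomorph M (EuclideanSpace ℝ (Fin n))}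

/-- An integral curve of the geodesic vector field in a chart gives a geodesic. -/
theorem IsNondegenerate.isGeodesicFrom_of_hasDerivAt (hg : g.IsNondegenerate)
    (hφ : φ ∈ IsManifold.maximalAtlas (𝓡 n) ∞ M) {q : M} (hq : q ∈ φ.source)
    {v : TangentSpace (𝓡 n) q} {z : ℝ → EuclideanSpace ℝ (Fin n) × EuclideanSpace ℝ (Fin n)}
    {a b : ℝ} (ha : a < 0) (hb : 1 < b) (hzt : ∀ t ∈ Ioo a b, (z t).1 ∈ φ.target)
    (hz : ∀ t ∈ Ioo a b, HasDerivAt z (geodesicField (g.christoffelMap φ) (z t)) t)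
    (hz0 : z 0 = (φ q, mfderiv (𝓡 n) (𝓡 n) φ q v)) :
    g.IsGeodesicFrom q v fun t ↦ φ.symm (z t).1 := by
  have h0 : (0 : ℝ) ∈ Ioo a b := ⟨ha, by linarith⟩
  have hX : ContDiffOn ℝ ∞ (geodesicField (g.christoffelMap φ)) (φ.target ×ˢ univ) := by
    intro x hx
    exact ((hg.contDiffOn_christoffelMap hφ).contDiffAt
      (φ.open_target.mem_nhds hx.1)).geodesicField.contDiffWithinAt
  have hzs : ContDiffOn ℝ ∞ (fun t ↦ (z t).1) (Ioo a b) := contDiff_fst.comp_contDiffOn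
    (contDiffOn_of_hasDerivAt_comp hX isOpen_Ioo (fun t ht ↦ ⟨hzt t ht, mem_univ _⟩) hz)
  have hz₁ : ∀ t ∈ Ioo a b, HasDerivAt (fun s ↦ (z s).1) (z t).2 t := fun t ht ↦ (hz t ht).fst
  have hz₂ : ∀ t ∈ Ioo a b, HasDerivAt (fun s ↦ (z s).2)
      (-g.christoffelMap φ (z t).1 (z t).2 (z t).2) t := fun t ht ↦ (hz t ht).snd
  have hev : ∀ t ∈ Ioo a b, (fun s ↦ φ (φ.symm (z s).1)) =ᶠ[𝓝 t] fun s ↦ (z s).1 := by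
    intro t ht
    filter_upwards [isOpen_Ioo.mem_nhds ht] with s hs
    exact φ.right_inv (hzt s hs)
  have hd : ∀ t ∈ Ioo a b, deriv (fun s ↦ φ (φ.symm (z s).1)) t = (z t).2 := fun t ht ↦
    (hev t ht).deriv_eq.trans (hz₁ t ht).deriv
  refine (isGeodesicFrom_iff hφ hq).2 ⟨⟨a, b, ha, hb, ?_⟩, ?_, ?_⟩
  · refine hg.isGeodesicOn_of_exists_chart isOpen_Ioo
      ((contMDiffOn_symm_of_mem_maximalAtlas hφ).comp hzs.contMDiffOn hzt) fun t ht ↦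
        ⟨φ, hφ, φ.map_target (hzt t ht), ?_⟩
    have hdd : deriv (deriv fun s ↦ φ (φ.symm (z s).1)) t =
        -g.christoffelMap φ (z t).1 (z t).2 (z t).2 := by
      refine Filter.EventuallyEq.deriv_eq (f₁ := deriv fun s ↦ φ (φ.symm (z s).1))
        (f := fun s ↦ (z s).2) ?_ |>.trans (hz₂ t ht).deriv
      filter_upwards [isOpen_Ioo.mem_nhds ht] with s hs
      exact hd s hs
    rw [hdd, hd t ht, φ.right_inv (hzt t ht), neg_add_cancel]
  · simp only [hz0]
    exact φ.left_inv hq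
  · rw [hd 0 h0, hz0]

set_option maxHeartbeats 400000 in
/-- Every point has arbitrarily small normal convex neighbourhoods. -/
theorem IsNondegenerate.exists_isNormalConvex [T2Space M] (hg : g.IsNondegenerate) (p : M)
    {W : Set M} (hW : W ∈ 𝓝 p) : ∃ U ⊆ W, p ∈ U ∧ g.IsNormalConvex U := by
  have hφ : chartAt (EuclideanSpace ℝ (Fin n)) p ∈ IsManifold.maximalAtlas (𝓡 n) ∞ M :=
    IsManifold.chart_mem_maximalAtlas _
  have hp : p ∈ (chartAt (EuclideanSpace ℝ (Fin n)) p).source := mem_chart_source _ _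
  set φ := chartAt (EuclideanSpace ℝ (Fin n)) p
  have hpt : φ p ∈ φ.target := φ.map_source hp
  -- a global extension `Γ` of the Christoffel symbols near `φ p`
  obtain ⟨Γ, hΓ, hΓφ⟩ := (hg.contDiffOn_christoffelMap hφ).exists_contDiff_eventuallyEq
    φ.open_target hpt
  have hWφ : ∀ᶠ y in 𝓝 (φ p), φ.symm y ∈ W :=
    (φ.continuousAt_symm hpt).eventually (by rwa [φ.left_inv hp])
  obtain ⟨ρ, hρ, hball⟩ := Metric.eventually_nhds_iff_ball.1
    ((hΓφ.and hWφ).and (φ.open_target.mem_nhds hpt))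
  obtain ⟨δ, ε, S, R, hδ, hε, hδρ, hS, hSs, hRs, hR⟩ := exists_convex_geodesic_ball hΓ (φ p) hρ
  have hU : IsOpen (φ.source ∩ φ ⁻¹' Metric.ball (φ p) δ) :=
    φ.isOpen_inter_preimage Metric.isOpen_ball
  refine ⟨φ.source ∩ φ ⁻¹' Metric.ball (φ p) δ, ?_, ⟨hp, Metric.mem_ball_self hδ⟩, hU, ?_⟩
  · rintro q ⟨hq, hqδ⟩
    have := (hball _ (Metric.ball_subset_ball hδρ hqδ)).1.2
    rwa [φ.left_inv hq] at this
  rintro q ⟨hq, hqδ : φ q ∈ Metric.ball (φ p) δ⟩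
  obtain ⟨L, hL⟩ : ∃ L : EuclideanSpace ℝ (Fin n) ≃L[ℝ] EuclideanSpace ℝ (Fin n),
      ∀ v : EuclideanSpace ℝ (Fin n), L v = mfderiv (𝓡 n) (𝓡 n) φ q v :=
    ⟨(mdifferentiable_of_mem_maximalAtlas hφ).mfderiv hq, fun _ ↦ rfl⟩
  -- for `v` in the coordinate ball, the coordinate solution is the geodesic of `g`
  have hgeo : ∀ v : EuclideanSpace ℝ (Fin n), L v ∈ Metric.ball 0 ε →
      g.IsGeodesicFrom q v fun t ↦ φ.symm (S (φ q, L v) t).1 := by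
    intro v hv
    obtain ⟨h0, hd, hρS, -⟩ := hS _ hqδ _ hv
    refine hg.isGeodesicFrom_of_hasDerivAt hφ hq (a := -1) (b := 2) (by norm_num) (by norm_num)
      (fun t ht ↦ (hball _ (hρS t (Ioo_subset_Icc_self ht))).2) (fun t ht ↦ ?_)
      (h0.trans (congrArg (Prod.mk (φ q)) (hL v)))
    refine (hd t ht).congr_deriv ?_
    rw [geodesicField, (hball _ (hρS t (Ioo_subset_Icc_self ht))).1.1]
    rfl
  have hexp : ∀ v : EuclideanSpace ℝ (Fin n), L v ∈ Metric.ball 0 ε →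
      g.expMap q v = φ.symm (S (φ q, L v) 1).1 := fun v hv ↦ hg.expMap_eq (hgeo v hv)
  have hLc : ∀ v : EuclideanSpace ℝ (Fin n), L v ∈ Metric.ball 0 ε → ∀ c ∈ Icc (0 : ℝ) 1,
      L (c • v) ∈ Metric.ball 0 ε := by
    intro v hv c hc
    rw [map_smul]
    exact (convex_ball 0 ε).smul_mem_of_zero_mem (Metric.mem_ball_self hε) hv hc
  have htar : ∀ v : EuclideanSpace ℝ (Fin n), L v ∈ Metric.ball 0 ε → ∀ c ∈ Icc (0 : ℝ) 1,
      (S (φ q, L v) c).1 ∈ φ.target := fun v hv c hc ↦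
    (hball _ ((hS _ hqδ _ hv).2.2.1 c ⟨by linarith [hc.1], by linarith [hc.2]⟩)).2
  -- homogeneity: both sides are the coordinates of `exp_q (c • v)`
  have hhom : ∀ v : EuclideanSpace ℝ (Fin n), L v ∈ Metric.ball 0 ε → ∀ c ∈ Icc (0 : ℝ) 1,
      (S (φ q, L (c • v)) 1).1 = (S (φ q, L v) c).1 := by
    intro v hv c hc
    have h1 := hexp _ (hLc v hv c hc)
    have h2 := hg.expMap_eq (hg.isGeodesicFrom_smul (hgeo v hv) hc)
    rw [mul_one] at h2
    exact φ.symm.injOn (htar _ (hLc v hv c hc) 1 (by simp)) (htar v hv c hc) (h1.symm.trans h2)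
  let V : Set (EuclideanSpace ℝ (Fin n)) :=
    L ⁻¹' Metric.ball 0 ε ∩ (fun v ↦ (S (φ q, L v) 1).1) ⁻¹' Metric.ball (φ p) δ
  have hVstar : ∀ v ∈ V, ∀ c ∈ Icc (0 : ℝ) 1, c • v ∈ V := by
    intro v hv c hc
    refine ⟨hLc v hv.1 c hc, ?_⟩
    rw [mem_preimage, hhom v hv.1 c hc]
    exact ((hS _ hqδ _ hv.1).2.2.2 hv.2).1 c hc
  -- `0 ∈ V` comes from homogeneity with the factor `0`, applied to `v = 0`
  have hL0 : L 0 ∈ Metric.ball 0 ε := by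
    rw [map_zero]
    exact Metric.mem_ball_self hε
  have h0V : (0 : EuclideanSpace ℝ (Fin n)) ∈ V := by
    refine ⟨hL0, ?_⟩
    have h1 := hhom 0 hL0 0 (by simp)
    rw [zero_smul, (hS _ hqδ _ hL0).1] at h1
    rwa [mem_preimage, h1]
  have hSq : ContDiffOn ℝ ∞ (fun v ↦ (S (φ q, L v) 1).1) (L ⁻¹' Metric.ball 0 ε) :=
    hSs.comp (contDiff_const.prodMk L.contDiff).contDiffOn fun v hv ↦ ⟨hqδ, hv⟩
  have hVo : IsOpen V := hSq.continuousOn.isOpen_inter_preimage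
    (Metric.isOpen_ball.preimage L.continuous) Metric.isOpen_ball
  have hφexp : ∀ v ∈ V, φ (g.expMap q v) = (S (φ q, L v) 1).1 := fun v hv ↦ by
    rw [hexp v hv.1]
    exact φ.right_inv (htar v hv.1 1 (by simp))
  have hVsc : StarConvex ℝ 0 V :=
    starConvex_zero_iff.2 fun v hv c hc0 hc1 ↦ hVstar v hv c ⟨hc0, hc1⟩
  have hVd : ∀ v ∈ V, (v : TangentSpace (𝓡 n) q) ∈ g.expDomain q :=
    fun v hv ↦ ⟨_, hgeo v hv.1⟩
  refine ⟨V, hVo, h0V, hVsc, hVd, ?_⟩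
  refine ⟨{ toFun := fun v ↦ g.expMap q v
            invFun := fun r ↦ L.symm (R (φ q, φ r))
            source := V
            target := φ.source ∩ φ ⁻¹' Metric.ball (φ p) δ
            map_source' := fun v hv ↦ ⟨?_, ?_⟩
            map_target' := fun r hr ↦ ⟨?_, ?_⟩
            left_inv' := fun v hv ↦ ?_
            right_inv' := fun r hr ↦ ?_
            open_source := hVo
            open_target := hU
            contMDiffOn_toFun := ?_
            contMDiffOn_invFun := ?_ }, rfl, rfl, fun _ _ ↦ rfl⟩
  · rw [hexp v hv.1]
    exact φ.map_target (htar v hv.1 1 (by simp))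
  · rw [mem_preimage, hφexp v hv]
    exact hv.2
  · rw [mem_preimage, L.apply_symm_apply]
    exact (hR _ hqδ _ hr.2).1
  · rw [mem_preimage, L.apply_symm_apply, (hR _ hqδ _ hr.2).2]
    exact hr.2
  · rw [hφexp v hv, ((hS _ hqδ _ hv.1).2.2.2 hv.2).2, L.symm_apply_apply]
  · have h1 := hR _ hqδ _ hr.2
    rw [hexp _ (by rw [L.apply_symm_apply]; exact h1.1), L.apply_symm_apply, h1.2,
      φ.left_inv hr.1]
  · refine ((contMDiffOn_symm_of_mem_maximalAtlas hφ).comp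
      (hSq.mono fun v hv ↦ hv.1).contMDiffOn fun v hv ↦ htar v hv.1 1 (by simp)).congr
      fun v hv ↦ hexp v hv.1
  · have h1 : ContDiffOn ℝ ∞ (fun y ↦ L.symm (R (φ q, y))) (Metric.ball (φ p) δ) :=
      L.symm.contDiff.comp_contDiffOn
        (hRs.comp (contDiff_const.prodMk contDiff_id).contDiffOn fun y hy ↦ ⟨hqδ, hy⟩)
    exact h1.contMDiffOn.comp ((contMDiffOn_of_mem_maximalAtlas hφ).mono inter_subset_left)
      fun r hr ↦ hr.2

/-! ### Intersections of normal convex sets -/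

/-- Let `f` map a star-shaped open set `V` into `U`, and let `k : U → V'` be a continuous left
inverse of `f` on an open set `V' ∋ 0`. Then `V ⊆ V'`: a ray in `V` cannot leave `V'`, as its image
stays in `U` and is lifted by `k`. -/
theorem source_subset_of_target_subset {F X : Type*} [NormedAddCommGroup F] [NormedSpace ℝ F]
    [TopologicalSpace X] {f : F → X} {V V' : Set F} (hV : IsOpen V) (hVs : StarConvex ℝ 0 V)
    (hV' : IsOpen V') (h0 : (0 : F) ∈ V') (hf : ContinuousOn f V) {U : Set X} (hU : IsOpen U)
    (hfU : MapsTo f V U) {k : X → F} (hk : ContinuousOn k U) (hkV' : MapsTo k U V')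
    (hkf : ∀ v ∈ V', k (f v) = v) : V ⊆ V' := by
  intro v hv
  have hVt : ∀ t ∈ Icc (0 : ℝ) 1, t • v ∈ V := fun t ht ↦ starConvex_zero_iff.1 hVs hv ht.1 ht.2
  have hcont : Continuous fun t : ℝ ↦ t • v := continuous_id.smul continuous_const
  suffices h : Icc (0 : ℝ) 1 ⊆ (fun t : ℝ ↦ t • v) ⁻¹' V' by
    simpa using h (right_mem_Icc.2 zero_le_one)
  refine isPreconnected_Icc.subset_of_closure_inter_subset (hV'.preimage hcont)
    ⟨0, by simp, by simpa using h0⟩ ?_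
  rintro t ⟨htc, ht⟩
  have hft : f (t • v) ∈ U := hfU (hVt t ht)
  have hlift : ContinuousAt (fun s : ℝ ↦ k (f (s • v))) t :=
    ContinuousAt.comp (g := k) (hk.continuousAt (hU.mem_nhds hft))
      (ContinuousAt.comp (g := f) (hf.continuousAt (hV.mem_nhds (hVt t ht))) hcont.continuousAt)
  have heq : k (f (t • v)) = t • v := by
    by_contra hne
    obtain ⟨s, hs, hs'⟩ := ((mem_closure_iff_frequently.1 htc).and_eventually
      ((hlift.ne_iff_eventually_ne hcont.continuousAt).1 hne)).exists
    exact hs' (hkf _ hs)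
  rw [mem_preimage, ← heq]
  exact hkV' hft

/-- Two normal convex sets that lie in a common normal convex set have a normal convex
intersection. -/
theorem IsNormalConvex.inter {U C C' : Set M} (hU : g.IsNormalConvex U)
    (hC : g.IsNormalConvex C) (hC' : g.IsNormalConvex C') (hCU : C ⊆ U) (hCU' : C' ⊆ U) :
    g.IsNormalConvex (C ∩ C') := by
  refine ⟨hC.1.inter hC'.1, fun q hq ↦ ?_⟩
  obtain ⟨V₀, hV₀, h0₀, -, -, Φ₀, rfl, rfl, hΦ₀⟩ := hU.2 q (hCU hq.1)
  obtain ⟨V, hV, h0, hVs, hVd, Φ, rfl, rfl, hΦ⟩ := hC.2 q hq.1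
  obtain ⟨V', hV', h0', hVs', hVd', Φ', rfl, rfl, hΦ'⟩ := hC'.2 q hq.2
  have hsub : ∀ {Ψ : PartialDiffeomorph (𝓡 n) (𝓡 n) (EuclideanSpace ℝ (Fin n)) M ∞},
      StarConvex ℝ 0 Ψ.source → (∀ v ∈ Ψ.source, Ψ v = g.expMap q v) → Ψ.target ⊆ Φ₀.target →
      Ψ.source ⊆ Φ₀.source := by
    intro Ψ hs hΨ ht
    refine source_subset_of_target_subset (F := EuclideanSpace ℝ (Fin n))
      (f := fun v ↦ g.expMap q v) (k := Φ₀.invFun)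
      Ψ.open_source hs hV₀ h0₀ (Ψ.contMDiffOn_toFun.continuousOn.congr fun v hv ↦ (hΨ v hv).symm)
      Φ₀.open_target (fun v hv ↦ ht ?_) Φ₀.contMDiffOn_invFun.continuousOn Φ₀.map_target' ?_
    · change g.expMap q v ∈ Ψ.target
      rw [← hΨ v hv]
      exact Ψ.map_source' hv
    · intro v hv
      rw [← hΦ₀ v hv]
      exact Φ₀.left_inv' hv
  have hinj : InjOn (fun v : EuclideanSpace ℝ (Fin n) ↦ g.expMap q v) Φ₀.source := by
    intro v hv w hw hvw
    change g.expMap q v = g.expMap q w at hvw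
    rw [← hΦ₀ v hv, ← hΦ₀ w hw] at hvw
    exact Φ₀.toPartialEquiv.injOn hv hw hvw
  have hinv : ∀ r ∈ Φ.target ∩ Φ'.target, Φ.invFun r = Φ'.invFun r := by
    intro r hr
    apply hinj (hsub hVs hΦ hCU (Φ.map_target' hr.1)) (hsub hVs' hΦ' hCU' (Φ'.map_target' hr.2))
    change g.expMap q (Φ.invFun r) = g.expMap q (Φ'.invFun r)
    rw [← hΦ _ (Φ.map_target' hr.1), ← hΦ' _ (Φ'.map_target' hr.2)]
    exact (Φ.right_inv' hr.1).trans (Φ'.right_inv' hr.2).symm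
  refine ⟨Φ.source ∩ Φ'.source, hV.inter hV', ⟨h0, h0'⟩, hVs.inter hVs', fun v hv ↦ hVd v hv.1,
    { toFun := Φ
      invFun := Φ.invFun
      source := Φ.source ∩ Φ'.source
      target := Φ.target ∩ Φ'.target
      map_source' := fun v hv ↦ ⟨Φ.map_source' hv.1, ?_⟩
      map_target' := fun r hr ↦ ⟨Φ.map_target' hr.1, ?_⟩
      left_inv' := fun v hv ↦ Φ.left_inv' hv.1
      right_inv' := fun r hr ↦ Φ.right_inv' hr.1
      open_source := hV.inter hV'
      open_target := hC.1.inter hC'.1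
      contMDiffOn_toFun := Φ.contMDiffOn_toFun.mono inter_subset_left
      contMDiffOn_invFun := Φ.contMDiffOn_invFun.mono inter_subset_left }, rfl, rfl,
    fun v hv ↦ hΦ v hv.1⟩
  · rw [hΦ v hv.1, ← hΦ' v hv.2]
    exact Φ'.map_source' hv.2
  · rw [hinv r hr]
    exact Φ'.map_target' hr.2

end SymmetricTensorField
end SemiRiemannian

/-! ### Coverings of paracompact spaces -/

/-- A paracompact Hausdorff space has barycentric refinements: given an open neighbourhood `N x` of
each point `x`, each point has a neighbourhood `W x` contained in some `N a`, such that two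
intersecting sets `W x`, `W y` are contained in a common `N a`. -/
theorem exists_nhds_subset_common {X : Type*} [TopologicalSpace X] [T2Space X]
    [ParacompactSpace X] {N : X → Set X} (hN : ∀ x, IsOpen (N x)) (hxN : ∀ x, x ∈ N x) :
    ∃ W : X → Set X, (∀ x, W x ∈ 𝓝 x) ∧ (∀ x, ∃ a, W x ⊆ N a) ∧
      ∀ x y, (W x ∩ W y).Nonempty → ∃ a, W x ⊆ N a ∧ W y ⊆ N a := by
  obtain ⟨v, hvo, hvc, hvf, hvN⟩ := precise_refinement N hN
    (eq_univ_of_forall fun x ↦ mem_iUnion.2 ⟨x, hxN x⟩)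
  obtain ⟨w, hwc, -, hwv⟩ := exists_iUnion_eq_closure_subset hvo hvf.point_finite hvc
  have hcl : LocallyFinite fun a ↦ closure (w a) := hvf.subset hwv
  have hw : ∀ x, ∃ a, x ∈ closure (w a) := fun x ↦
    (mem_iUnion.1 (hwc ▸ mem_univ x)).imp fun a ha ↦ subset_closure ha
  let W : X → Set X := fun x ↦ (⋂ a ∈ {a | x ∈ closure (w a)}, v a) ∩
    ⋂ (a) (_ : x ∉ closure (w a)), (closure (w a))ᶜ
  have hW : ∀ x a, x ∈ closure (w a) → W x ⊆ N a := fun x a ha z hz ↦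
    hvN a (mem_iInter₂.1 hz.1 a ha)
  refine ⟨W, fun x ↦ ?_, fun x ↦ (hw x).imp (hW x), ?_⟩
  · refine Filter.inter_mem ?_ (hcl.iInter_compl_mem_nhds (fun _ ↦ isClosed_closure) x)
    exact (Filter.biInter_mem (hcl.point_finite x)).2 fun a ha ↦ (hvo a).mem_nhds (hwv a ha)
  · rintro x y ⟨z, hzx, hzy⟩
    obtain ⟨a, ha⟩ := hw z
    have hmem : ∀ x, z ∈ W x → x ∈ closure (w a) := by
      intro x hx
      by_contra hxa
      exact mem_iInter₂.1 hx.2 a hxa ha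
    exact ⟨a, hW x a (hmem x hzx), hW y a (hmem y hzy)⟩

end

open SemiRiemannian in
theorem proposition2p2 {n : ℕ} {M : Type*} [TopologicalSpace M]
    [ChartedSpace (EuclideanSpace ℝ (Fin n)) M] [IsManifold (𝓡 n) ∞ M]
    [T2Space M] [ParacompactSpace M]
    (g : SymmetricTensorField n M) (hg : g.IsRiemannian ∨ g.IsLorentzian)
    (𝒜 : Set (Set M)) (hopen : ∀ A ∈ 𝒜, IsOpen A) (hcover : ⋃₀ 𝒜 = Set.univ) :
    ∃ 𝒞 : Set (Set M), g.IsStronglyConvexCovering 𝒞 ∧ ∀ C ∈ 𝒞, ∃ A ∈ 𝒜, C ⊆ A := by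
  have hnd : g.IsNondegenerate := hg.elim (·.isNondegenerate) (·.isNondegenerate)
  have hN : ∀ x : M, ∃ U, x ∈ U ∧ g.IsNormalConvex U ∧ ∃ A ∈ 𝒜, U ⊆ A := by
    intro x
    obtain ⟨A, hA, hxA⟩ := mem_sUnion.1 (hcover ▸ mem_univ x)
    obtain ⟨U, hUA, hxU, hU⟩ := hnd.exists_isNormalConvex x ((hopen A hA).mem_nhds hxA)
    exact ⟨U, hxU, hU, A, hA, hUA⟩
  choose N hxN hNconv hNA using hN
  obtain ⟨W, hW, hWN, hWW⟩ := exists_nhds_subset_common (fun x ↦ (hNconv x).1) hxN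
  choose C hCW hxC hCconv using fun x ↦ hnd.exists_isNormalConvex x (hW x)
  refine ⟨range C, ⟨?_, ?_, ?_⟩, ?_⟩
  · exact eq_univ_of_forall fun x ↦ mem_sUnion.2 ⟨C x, mem_range_self x, hxC x⟩
  · rintro _ ⟨x, rfl⟩
    exact hCconv x
  · rintro _ ⟨x, rfl⟩ _ ⟨y, rfl⟩ hne
    obtain ⟨a, hxa, hya⟩ := hWW x y (hne.mono (inter_subset_inter (hCW x) (hCW y)))
    exact (hNconv a).inter (hCconv x) (hCconv y) ((hCW x).trans hxa) ((hCW y).trans hya)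
  · rintro _ ⟨x, rfl⟩
    obtain ⟨a, ha⟩ := hWN x
    obtain ⟨A, hA, hNA⟩ := hNA a
    exact ⟨A, hA, ((hCW x).trans ha).trans hNA⟩
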